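/- **Setting.** A ball of radius $r>0$ and total mass $m_T>0$ rolls without slipping on a horizontal plane and is driven by three internal rotors. Its state is $q=(R_s,\omega_s,\dot\Theta)\in SO(3)\times\mathbb R^3\times\mathbb R^3$ (attitude, body angular velocity, rotor rates). Let $I^s=\mathrm{diag}(I_1,I_2,I_3)$ and $\mathbb J=J_a\,\mathrm{Id}$ with $I_i,J_a>0$, $\Gamma=R_s^T\hat e_3$, and $M=M(\Gamma)=I^s+m_Tr^2\,\widehat\Gamma^T\widehat\Gamma$, where $\widehat x\,y=x\times y$ and $(\cdot)^\vee$ is the inverse of the hat map. With rotor torque $u$ the equations of motion are $$\dot R_s=R_s\widehat\omega_s,\qquad M\dot\omega_s=(I^s\omega_s+\mathbb J\dot\Theta)\times\omega_s-u,\qquad \mathbb J\dot\omega_s+\mathbb J\ddot\Theta=u,$$ that is, $\dot q=f(q)+\sum_i g_i(q)u_i$. Let $R_d:\mathbb R\to SO(3)$ be $C^2$ and put $\widehat\omega_d=R_d^T\dot R_d$, $R_e=R_d^TR_s$, $e_\omega=\omega_s-R_e^T\omega_d$. Let $K_p=\mathrm{diag}(\lambda_1,\lambda_2,\lambda_3)$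 with all $\lambda_i>0$, and let $$V=\mathrm{trace}\big(K_p(\mathrm{Id}-R_e)\big),\qquad dV=\big(K_pR_e-(K_pR_e)^T\big)^\vee,\qquad H=V+\tfrac12\,e_\omega\cdot Me_\omega .$$ Let $f_{FF}$ be a feedforward torque which is either (a) $f_{FF}=M\big(\omega_s\times R_e^T\omega_d+R_e^T\dot\omega_d+\nabla_{\omega_s}(R_e^T\omega_d)\big)$ with $\nabla_\xi\eta=M^{-1}\big(\tfrac12\,\xi\times M\eta+\tfrac12\,\eta\times M\xi\big)$, or, more generally, (b) any $C^1$ function of $(R_s,\omega_s,\dot\Theta,R_d,\omega_d,\dot\omega_d)$, provided that $\omega_d$ and $\dot\omega_d$ are bounded on $[0,\infty)$. With $u=dV-f_{FF}+u_{diss}$ the system becomes $$\dot q=F_{cl}(t,q)+\sum_i g_i(q)\,u_{diss}^i,\qquad F_{cl}=f+\sum_i g_i\,(dV-f_{FF})_i .$$ Here $\mathcal L_{F_{cl}}H$ includes the explicit time derivative of $H$ (through $R_d$ and $\omega_d$), and $\mathcal L_gH=(\mathcal L_{g_1}H,\mathcal L_{g_2}H,\mathcal L_{g_3}H)$. **Theorem.**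 Suppose that $\mathcal L_{F_{cl}}H=0$ at all times $t\ge0$ and all states. Let $K_v>0$ and choose the dissipative input $u_{diss}=-K_v\,\mathcal L_gH$ (that is, $u_{diss}=-\mathcal L_gH$ for $K_v=1$). Then: 1. $u_{diss}=K_v\,e_\omega$. 2. Along every solution of the closed-loop system in times $t\ge 0$, $\dfrac{dH}{dt}=-K_v\|e_\omega\|^2\le0$. 3. $(R_d,\omega_d)$ is locally asymptotically stable in the variables $(R_s,\omega_s)$, for any rotor rates: for every initial time $t_0\ge0$, (i) for every $\varepsilon>0$ there is $\delta>0$ such that every solution on $[t_0,\infty)$ with $(R_s,\omega_s)(t_0)$ within $\delta$ of $(R_d,\omega_d)(t_0)$ stays within $\varepsilon$ of $(R_d,\omega_d)(t)$ for all $t\ge t_0$; and (ii) there is $\delta>0$ such that from every state whose $(R_s,\omega_s)$ is within $\delta$ of $(R_d,\omega_d)(t_0)$ a solution on $[t_0,\infty)$ exists, and every solution on $[t_0,\infty)$ starting from such a state satisfies $R_s(t)-R_d(t)\to0$ and $\omega_s(t)-\omega_d(t)\to0$. -/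

import Mathlib

open Matrix Set Filter Topology

/-- Vectors of `ℝ³`, in body or inertial coordinates. -/
abbrev Vec : Type := Fin 3 → ℝ

/-- Real `3 × 3` matrices. -/
abbrev Mat : Type := Matrix (Fin 3) (Fin 3) ℝ

attribute [local instance] Matrix.normedAddCommGroup Matrix.normedSpace

/-- States `q = (R_s, ω_s, Θ')`: attitude, angular velocity in the sphere frame, rotor rates.
The attitude is written as a matrix; that it lies in `SO(3)` is required where states are used. -/
abbrev State : Type := Mat × Vec × Vec

/-- The rotation group, as a set of matrices. -/
abbrev SO3 : Set Mat := {R | R ∈ Matrix.specialOrthogonalGroup (Fin 3) ℝ}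

/-- The hat map: `hat w *ᵥ v = w × v`. -/
def hat (w : Vec) : Mat := !![0, -w 2, w 1; w 2, 0, -w 0; -w 1, w 0, 0]

/-- The inverse of the hat map on skew-symmetric matrices. -/
def vee (A : Mat) : Vec := ![A 2 1, A 0 2, A 1 0]

/-- Parameters of the robot: total mass, radius, the diagonal entries `I₁, I₂, I₃` of the inertia
matrix `I^s` of the sphere, and the axial moment of inertia `J_a` of each rotor. -/
structure Robot where
  mT : ℝ
  r : ℝ
  I : Vec
  Ja : ℝ
  mT_pos : 0 < mT
  r_pos : 0 < r
  I_pos : ∀ i, 0 < I i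
  Ja_pos : 0 < Ja

/-- A feedforward law: a torque depending on
`(R_s, ω_s, Θ')` and on the data `(R_d, ω_d, ω_d')` of the desired trajectory. -/
abbrev FeedforwardLaw : Type := Mat × Vec × Vec × Mat × Vec × Vec → Vec

/-- The body angular velocity `ω_d` of the desired attitude: `hat ω_d = R_dᵀ R_d'`. -/
noncomputable def desiredVelocity (Rd : ℝ → Mat) (t : ℝ) : Vec := vee ((Rd t)ᵀ * deriv Rd t)

/-- `R_eᵀ ω_d`, where `R_e = R_dᵀ R_s`. -/
def transported (Rd R : Mat) (ωd : Vec) : Vec := (Rdᵀ * R)ᵀ *ᵥ ωd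

/-- The angular velocity error `e_ω = ω_s - R_eᵀ ω_d`. -/
noncomputable def velocityError (Rd : ℝ → Mat) (t : ℝ) (q : State) : Vec :=
  q.2.1 - transported (Rd t) q.1 (desiredVelocity Rd t)

/-- The modified trace potential `V = trace (K_p (1 - R_dᵀ R_s))`, `K_p = diag lam`. -/
def potential (lam : Vec) (Rd R : Mat) : ℝ :=
  (Matrix.diagonal lam * (1 - Rdᵀ * R)).trace

/-- The differential `dV = (K_p R_dᵀ R_s - (K_p R_dᵀ R_s)ᵀ)^∨` of the potential:
`V' = dV ⬝ e_ω` along `R_s' = R_s hat ω_s`, `R_d' = R_d hat ω_d`. -/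
def potentialDiff (lam : Vec) (Rd R : Mat) : Vec :=
  vee (Matrix.diagonal lam * (Rdᵀ * R) - (Matrix.diagonal lam * (Rdᵀ * R))ᵀ)

namespace Robot

/-- The advected vector `Γ = R_sᵀ e₃`. -/
def Gam (R : Mat) : Vec := Rᵀ *ᵥ ![0, 0, 1]

/-- The locked inertia matrix `M(Γ) = I^s - m_T r² hat Γ hat Γ = I^s + m_T r² (hat Γ)ᵀ hat Γ`. -/
def M (P : Robot) (R : Mat) : Mat :=
  Matrix.diagonal P.I + (P.mT * P.r ^ 2) • ((hat (Gam R))ᵀ * hat (Gam R))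

/-- The Lyapunov function `H = V + ½ e_ω ⬝ M e_ω`. -/
noncomputable def H (P : Robot) (lam : Vec) (Rd : ℝ → Mat) (t : ℝ) (q : State) : ℝ :=
  potential lam (Rd t) q.1
    + 1 / 2 * (velocityError Rd t q ⬝ᵥ (P.M q.1 *ᵥ velocityError Rd t q))

/-- The bilinear map `M⁻¹ (½ ξ × M η + ½ η × M ξ)`. -/
noncomputable def connection (P : Robot) (R : Mat) (ξ η : Vec) : Vec :=
  (P.M R)⁻¹ *ᵥ ((1 / 2 : ℝ) • crossProduct ξ (P.M R *ᵥ η)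
    + (1 / 2 : ℝ) • crossProduct η (P.M R *ᵥ ξ))

/-- The feedforward torque
`f_FF = M (ω_s × R_eᵀ ω_d + R_eᵀ ω_d' + ∇_{ω_s} (R_eᵀ ω_d))`. -/
noncomputable def feedforward (P : Robot) : FeedforwardLaw :=
  fun (R, ω, _, Rd, ωd, ωd') =>
    P.M R *ᵥ (crossProduct ω (transported Rd R ωd) + transported Rd R ωd'
      + P.connection R ω (transported Rd R ωd))

/-- The drift `f` of the uncontrolled robot: `R_s' = R_s hat ω_s`,
`M ω_s' = (I^s ω_s + J Θ') × ω_s`, `J ω_s' + J Θ'' = 0`. -/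
noncomputable def drift (P : Robot) (q : State) : State :=
  let a : Vec := (P.M q.1)⁻¹ *ᵥ
    crossProduct (Matrix.diagonal P.I *ᵥ q.2.1 + P.Ja • q.2.2) q.2.1
  (q.1 * hat q.2.1, a, -a)

/-- The control vector field `g_i`: a torque `u` on the rotors contributes `-u` to `M ω_s'` and `u`
to `J ω_s' + J Θ''`, so the `ω_s`-part of `g_i` is minus the `i`-th column of `M⁻¹`. -/
noncomputable def g (P : Robot) (i : Fin 3) (q : State) : State :=
  (0, -((P.M q.1)⁻¹ *ᵥ Pi.single i 1), P.Ja⁻¹ • Pi.single i 1 + (P.M q.1)⁻¹ *ᵥ Pi.single i 1)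

/-- `F_cl = f + g (dV - f_FF)`. -/
noncomputable def Fcl (P : Robot) (lam : Vec) (fFF : FeedforwardLaw) (Rd : ℝ → Mat)
    (t : ℝ) (q : State) : State :=
  P.drift q + ∑ i, (potentialDiff lam (Rd t) q.1
    - fFF (q.1, q.2.1, q.2.2, Rd t, desiredVelocity Rd t, deriv (desiredVelocity Rd) t)) i
      • P.g i q

/-- The Lie derivative `D_q H(t, q) [g_i(q)]` of `H(t, .)` along `g_i`. -/
noncomputable def lieG (P : Robot) (lam : Vec) (Rd : ℝ → Mat) (t : ℝ) (q : State)
    (i : Fin 3) : ℝ :=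
  lineDeriv ℝ (P.H lam Rd t) q (P.g i q)

/-- The dissipative input `u_diss = - K_v L_g H` with gain `K_v`; `K_v = 1` gives `- L_g H`. -/
noncomputable def uDiss (P : Robot) (lam : Vec) (Kv : ℝ) (Rd : ℝ → Mat) (t : ℝ) (q : State) :
    Vec :=
  fun i => -(Kv * P.lieG lam Rd t q i)

/-- The closed-loop system `q' = F_cl(q) + g(q) u_diss`. -/
noncomputable def closedLoop (P : Robot) (lam : Vec) (Kv : ℝ) (fFF : FeedforwardLaw)
    (Rd : ℝ → Mat) (t : ℝ) (q : State) : State :=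
  P.Fcl lam fFF Rd t q + ∑ i, P.uDiss lam Kv Rd t q i • P.g i q

end Robot

/-- The Lie derivative `∂H/∂t + D_q H [F]` of a time-dependent function along a time-dependent
vector field. -/
noncomputable def lieDeriv (F : ℝ → State → State) (H : ℝ → State → ℝ) (t : ℝ) (q : State) : ℝ :=
  deriv (fun s : ℝ => H (t + s) (q + s • F t q)) 0

/-- `q` is a solution of `q' = F(t, q)` on the time set `s`, with attitude in `SO(3)`. -/
def IsTrajectoryOn (F : ℝ → State → State) (s : Set ℝ) (q : ℝ → State) : Prop :=
  ∀ t ∈ s, (q t).1 ∈ SO3 ∧ HasDerivWithinAt q (F t (q t)) s t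

/-- The attitude and angular velocity of `x` are within `ε` of `(R, ω)`. -/
def Near (R : Mat) (ω : Vec) (ε : ℝ) (x : State) : Prop :=
  ‖x.1 - R‖ < ε ∧ ‖x.2.1 - ω‖ < ε

/-- Local asymptotic stability of the trajectory `(R_d, ω_d)` in the variables `(R_s, ω_s)`, for
every initial time `t₀ ≥ 0` and without restriction on the rotor rates: solutions from nearby
states exist for all later times, stay close to the trajectory, and converge to it. -/
def LocallyAsymptoticallyStable (F : ℝ → State → State) (Rd : ℝ → Mat) (ωd : ℝ → Vec) : Prop :=
  ∀ t₀ : ℝ, 0 ≤ t₀ →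
    (∀ ε > 0, ∃ δ > 0, ∀ q : ℝ → State, IsTrajectoryOn F (Ici t₀) q →
      Near (Rd t₀) (ωd t₀) δ (q t₀) → ∀ t ≥ t₀, Near (Rd t) (ωd t) ε (q t)) ∧
    (∃ δ > 0,
      (∀ x : State, x.1 ∈ SO3 → Near (Rd t₀) (ωd t₀) δ x →
        ∃ q : ℝ → State, IsTrajectoryOn F (Ici t₀) q ∧ q t₀ = x) ∧
      (∀ q : ℝ → State, IsTrajectoryOn F (Ici t₀) q → Near (Rd t₀) (ωd t₀) δ (q t₀) →
        Tendsto (fun t => (q t).1 - Rd t) atTop (𝓝 0) ∧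
        Tendsto (fun t => (q t).2.1 - ωd t) atTop (𝓝 0)))

/-! Write `Q = R_dᵀ R_s`, `e` for `velocityError`, `z` for `attitudeError` and `Y` for `residual`.
Then `Q' = Q hat e` and `V' = dV ⬝ e`, and along the closed loop `(M e)' = Y - dV - K_v e`. The
derivative of `H` along `F_cl` is `e ⬝ (Y - ½ M' e)`. The hypothesis makes it vanish at every state,
so the damping alone survives and `H' = -K_v e ⬝ e`.

This rate does not see the attitude error and the system is time-dependent, so convergence is
obtained from a strict Lyapunov function. Dividing the power identity by the length of `e` and
letting `e → 0` shows that `Y` vanishes at `e = 0` (`residual_eq_zero`). As `Y` is `C¹` with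
arguments in a bounded set, `‖Y‖ ≤ L ‖e‖` (`exists_norm_residual_le`). The identity `z ⬝ dV = (1 +
tr Q) V` (`attitudeError_dotProduct_potentialDiff`) then gives `(z ⬝ M e)' ≤ C₁ ‖e‖² - V / 2` while
`V` is small (`crossTerm_deriv_le`). For small `c`, `W = H + c z ⬝ M e` satisfies `W' ≤ -κ H`. Since
`W` is bounded below and `H` is nonincreasing, `H → 0` (`tendsto_H`). Small `H` means closeness to
the desired motion, uniformly in time because `ω_d` is bounded.

The rotor rates do not enter `H`. They are bounded because the angular momentum about the contact
point, in inertial axes, is conserved (`hasDerivWithinAt_momentum`). The same a priori bound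
excludes blow-up and yields solutions for all later times. For the explicit feedforward torque the
hypothesis forces `ω_d = 0` for `t ≥ 0` (`desiredVelocity_eq_zero_of_feedforward`), so boundedness
is automatic there. -/

section Calculus

/-! ### Entrywise differentiation rules for matrices and vectors. -/

variable {s : Set ℝ} {t : ℝ}

theorem hasDerivWithinAt_matrix {A : ℝ → Mat} {A' : Mat} :
    HasDerivWithinAt A A' s t ↔ ∀ i j, HasDerivWithinAt (fun τ => A τ i j) (A' i j) s t := by
  refine (hasDerivWithinAt_pi (φ := A) (φ' := A')).trans (forall_congr' fun i => ?_)
  exact hasDerivWithinAt_pi (φ := fun τ => A τ i) (φ' := A' i)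

theorem HasDerivWithinAt.matrix_mul {A B : ℝ → Mat} {A' B' : Mat}
    (hA : HasDerivWithinAt A A' s t) (hB : HasDerivWithinAt B B' s t) :
    HasDerivWithinAt (fun τ => A τ * B τ) (A' * B t + A t * B') s t := by
  rw [hasDerivWithinAt_matrix] at *
  intro i j
  simp only [Matrix.mul_apply, Matrix.add_apply, ← Finset.sum_add_distrib]
  exact HasDerivWithinAt.fun_sum fun k _ => (hA i k).mul (hB k j)

theorem HasDerivWithinAt.matrix_transpose {A : ℝ → Mat} {A' : Mat}
    (hA : HasDerivWithinAt A A' s t) : HasDerivWithinAt (fun τ => (A τ)ᵀ) A'ᵀ s t := by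
  rw [hasDerivWithinAt_matrix] at *
  exact fun i j => hA j i

theorem HasDerivWithinAt.matrix_mulVec {A : ℝ → Mat} {A' : Mat} {v : ℝ → Vec} {v' : Vec}
    (hA : HasDerivWithinAt A A' s t) (hv : HasDerivWithinAt v v' s t) :
    HasDerivWithinAt (fun τ => A τ *ᵥ v τ) (A' *ᵥ v t + A t *ᵥ v') s t := by
  rw [hasDerivWithinAt_matrix] at hA
  rw [hasDerivWithinAt_pi] at *
  intro i
  simp only [Matrix.mulVec, dotProduct, Pi.add_apply, ← Finset.sum_add_distrib]
  exact HasDerivWithinAt.fun_sum fun k _ => (hA i k).mul (hv k)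

theorem HasDerivWithinAt.vec_dotProduct {v w : ℝ → Vec} {v' w' : Vec}
    (hv : HasDerivWithinAt v v' s t) (hw : HasDerivWithinAt w w' s t) :
    HasDerivWithinAt (fun τ => v τ ⬝ᵥ w τ) (v' ⬝ᵥ w t + v t ⬝ᵥ w') s t := by
  rw [hasDerivWithinAt_pi] at *
  simp only [dotProduct, ← Finset.sum_add_distrib]
  exact HasDerivWithinAt.fun_sum fun k _ => (hv k).mul (hw k)

theorem HasDerivWithinAt.matrix_trace {A : ℝ → Mat} {A' : Mat}
    (hA : HasDerivWithinAt A A' s t) :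
    HasDerivWithinAt (fun τ => (A τ).trace) A'.trace s t := by
  rw [hasDerivWithinAt_matrix] at hA
  exact HasDerivWithinAt.fun_sum fun k _ => hA k k

theorem HasDerivWithinAt.vee_comp {A : ℝ → Mat} {A' : Mat}
    (hA : HasDerivWithinAt A A' s t) :
    HasDerivWithinAt (fun τ => vee (A τ)) (vee A') s t := by
  rw [hasDerivWithinAt_matrix] at hA
  rw [hasDerivWithinAt_pi]
  intro i
  fin_cases i
  exacts [hA 2 1, hA 0 2, hA 1 0]

theorem HasDerivWithinAt.hat_comp {v : ℝ → Vec} {v' : Vec}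
    (hv : HasDerivWithinAt v v' s t) :
    HasDerivWithinAt (fun τ => hat (v τ)) (hat v') s t := by
  rw [hasDerivWithinAt_pi] at hv
  rw [hasDerivWithinAt_matrix]
  have h0 := hasDerivWithinAt_const t s (0 : ℝ)
  intro i j
  fin_cases i <;> fin_cases j
  exacts [h0, (hv 2).neg, hv 1, hv 2, h0, (hv 0).neg, (hv 1).neg, hv 0, h0]

end Calculus

/-! ### Smoothness of the matrix and vector operations. -/

section Smoothness

variable {E : Type*} [NormedAddCommGroup E] [NormedSpace ℝ E] {n : WithTop ℕ∞}

theorem contDiff_matrix {A : E → Mat} :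
    ContDiff ℝ n A ↔ ∀ i j, ContDiff ℝ n fun x => A x i j := by
  refine (contDiff_pi (Φ := A)).trans (forall_congr' fun i => ?_)
  exact contDiff_pi (Φ := fun x => A x i)

theorem ContDiff.matrix_mul {A B : E → Mat} (hA : ContDiff ℝ n A) (hB : ContDiff ℝ n B) :
    ContDiff ℝ n fun x => A x * B x := by
  rw [contDiff_matrix] at *
  intro i j
  simp only [Matrix.mul_apply]
  exact ContDiff.sum fun k _ => (hA i k).mul (hB k j)

theorem ContDiff.matrix_transpose {A : E → Mat} (hA : ContDiff ℝ n A) :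
    ContDiff ℝ n fun x => (A x)ᵀ := by
  rw [contDiff_matrix] at *
  exact fun i j => hA j i

theorem ContDiff.matrix_mulVec {A : E → Mat} {v : E → Vec} (hA : ContDiff ℝ n A)
    (hv : ContDiff ℝ n v) : ContDiff ℝ n fun x => A x *ᵥ v x := by
  rw [contDiff_matrix] at hA
  rw [contDiff_pi] at *
  intro i
  simp only [Matrix.mulVec, dotProduct]
  exact ContDiff.sum fun k _ => (hA i k).mul (hv k)

theorem ContDiff.vec_dotProduct {v w : E → Vec} (hv : ContDiff ℝ n v) (hw : ContDiff ℝ n w) :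
    ContDiff ℝ n fun x => v x ⬝ᵥ w x := by
  rw [contDiff_pi] at *
  exact ContDiff.sum fun k _ => (hv k).mul (hw k)

theorem ContDiff.matrix_trace {A : E → Mat} (hA : ContDiff ℝ n A) :
    ContDiff ℝ n fun x => (A x).trace := by
  rw [contDiff_matrix] at hA
  exact ContDiff.sum fun k _ => hA k k

theorem ContDiff.vee_comp {A : E → Mat} (hA : ContDiff ℝ n A) :
    ContDiff ℝ n fun x => vee (A x) := by
  rw [contDiff_matrix] at hA
  rw [contDiff_pi]
  intro i
  fin_cases i
  exacts [hA 2 1, hA 0 2, hA 1 0]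

theorem ContDiff.hat_comp {v : E → Vec} (hv : ContDiff ℝ n v) :
    ContDiff ℝ n fun x => hat (v x) := by
  rw [contDiff_pi] at hv
  rw [contDiff_matrix]
  have h0 : ContDiff ℝ n fun _ : E => (0 : ℝ) := contDiff_const
  intro i j
  fin_cases i <;> fin_cases j
  exacts [h0, (hv 2).neg, hv 1, hv 2, h0, (hv 0).neg, (hv 1).neg, hv 0, h0]

theorem hat_mulVec (v w : Vec) : hat v *ᵥ w = crossProduct v w := by
  ext i
  fin_cases i <;> simp [hat, cross_apply, Matrix.mulVec, dotProduct, Fin.sum_univ_three] <;> ring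

theorem ContDiff.vec_cross {v w : E → Vec} (hv : ContDiff ℝ n v) (hw : ContDiff ℝ n w) :
    ContDiff ℝ n fun x => crossProduct (v x) (w x) := by
  simp only [← hat_mulVec]
  exact hv.hat_comp.matrix_mulVec hw

theorem ContDiff.matrix_det {A : E → Mat} (hA : ContDiff ℝ n A) :
    ContDiff ℝ n fun x => (A x).det := by
  rw [contDiff_matrix] at hA
  simp only [Matrix.det_fin_three]
  fun_prop

theorem ContDiff.matrix_inv {A : E → Mat} (hA : ContDiff ℝ n A) (h : ∀ x, (A x).det ≠ 0) :
    ContDiff ℝ n fun x => (A x)⁻¹ := by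
  have hd := hA.matrix_det
  rw [contDiff_matrix]
  intro i j
  simp only [Matrix.inv_def, Matrix.smul_apply, Ring.inverse_eq_inv', smul_eq_mul,
    Matrix.adjugate_apply]
  refine (hd.inv h).mul (ContDiff.matrix_det ?_)
  rw [contDiff_matrix] at hA ⊢
  intro k l
  simp only [Matrix.updateRow_apply]
  split_ifs
  · exact contDiff_const
  · exact hA k l

end Smoothness

/-! ### Rotations and the hat map. -/

theorem SO3.mul_transpose {R : Mat} (h : R ∈ SO3) : R * Rᵀ = 1 :=
  (Matrix.mem_orthogonalGroup_iff (Fin 3) ℝ).1 (Matrix.mem_specialOrthogonalGroup_iff.1 h).1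

theorem SO3.transpose_mul {R : Mat} (h : R ∈ SO3) : Rᵀ * R = 1 :=
  (Matrix.mem_orthogonalGroup_iff' (Fin 3) ℝ).1 (Matrix.mem_specialOrthogonalGroup_iff.1 h).1

theorem SO3.det_eq_one {R : Mat} (h : R ∈ SO3) : R.det = 1 :=
  (Matrix.mem_specialOrthogonalGroup_iff.1 h).2

theorem mem_SO3_of {R : Mat} (h : R * Rᵀ = 1) (hd : R.det = 1) : R ∈ SO3 :=
  Matrix.mem_specialOrthogonalGroup_iff.2 ⟨(Matrix.mem_orthogonalGroup_iff (Fin 3) ℝ).2 h, hd⟩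

theorem SO3.transpose_mul_mem {Q R : Mat} (hQ : Q ∈ SO3) (hR : R ∈ SO3) : Qᵀ * R ∈ SO3 := by
  refine mem_SO3_of ?_ ?_
  · rw [Matrix.transpose_mul, Matrix.transpose_transpose, Matrix.mul_assoc, ← Matrix.mul_assoc R,
      SO3.mul_transpose hR, Matrix.one_mul, SO3.transpose_mul hQ]
  · rw [Matrix.det_mul, Matrix.det_transpose, SO3.det_eq_one hQ, SO3.det_eq_one hR, one_mul]

theorem SO3.adjugate_eq {R : Mat} (h : R ∈ SO3) : R.adjugate = Rᵀ := by
  have h1 := Matrix.mul_adjugate R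
  rw [SO3.det_eq_one h, one_smul] at h1
  calc R.adjugate = (Rᵀ * R) * R.adjugate := by rw [SO3.transpose_mul h, Matrix.one_mul]
    _ = Rᵀ := by rw [Matrix.mul_assoc, h1, Matrix.mul_one]

/-- A polynomial identity valid for every matrix, dual to `Qx × Qy = cof(Q)(x × y)`. For a rotation
the adjugate is the transpose, and it becomes the equivariance of the hat map. -/
theorem hat_adjugate_mulVec (Q : Mat) (w : Vec) : hat (Q.adjugate *ᵥ w) = Qᵀ * hat w * Q := by
  ext i j
  fin_cases i <;> fin_cases j <;>
    simp [hat, Matrix.adjugate_fin_three, Matrix.mulVec, dotProduct, Fin.sum_univ_three,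
      Matrix.mul_apply] <;> ring

theorem SO3.mul_hat {Q : Mat} (h : Q ∈ SO3) (w : Vec) : Q * hat (Qᵀ *ᵥ w) = hat w * Q := by
  rw [← SO3.adjugate_eq h, hat_adjugate_mulVec, ← Matrix.mul_assoc, ← Matrix.mul_assoc,
    SO3.mul_transpose h, Matrix.one_mul]

theorem hat_transpose (w : Vec) : (hat w)ᵀ = -hat w := by
  ext i j
  fin_cases i <;> fin_cases j <;> simp [hat]

theorem hat_vee {A : Mat} (h : Aᵀ = -A) : hat (vee A) = A := by
  have h' : ∀ i j, A j i = -A i j := fun i j => congrFun (congrFun h i) j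
  have h0 := h' 0 0
  have h1 := h' 1 1
  have h2 := h' 2 2
  ext i j
  fin_cases i <;> fin_cases j <;> simp [hat, vee] <;> first | linarith | linarith [h' 0 1] | linarith [h' 0 2] | linarith [h' 1 2]

theorem neg_trace_mul_hat (A : Mat) (w : Vec) : -(A * hat w).trace = vee (A - Aᵀ) ⬝ᵥ w := by
  simp [hat, vee, Matrix.trace, Matrix.mul_apply, dotProduct, Fin.sum_univ_three]
  ring

/-! ### Locked inertia, forced dynamics and the damping input. -/

namespace Robot

variable (P : Robot)

theorem M_posDef (R : Mat) : (P.M R).PosDef := by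
  refine (Matrix.PosDef.diagonal P.I_pos).add_posSemidef ?_
  have h := Matrix.posSemidef_conjTranspose_mul_self (hat (Gam R))
  rw [Matrix.conjTranspose_eq_transpose_of_trivial] at h
  exact h.smul (by have := P.mT_pos; positivity)

theorem M_det_ne_zero (R : Mat) : (P.M R).det ≠ 0 := (P.M_posDef R).det_pos.ne'

theorem M_transpose (R : Mat) : (P.M R)ᵀ = P.M R := by
  have h := (P.M_posDef R).isHermitian.eq
  rwa [Matrix.conjTranspose_eq_transpose_of_trivial] at h

theorem M_mulVec_inv (R : Mat) (v : Vec) : P.M R *ᵥ ((P.M R)⁻¹ *ᵥ v) = v := by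
  rw [Matrix.mulVec_mulVec, Matrix.mul_nonsing_inv _ (P.M_det_ne_zero R).isUnit,
    Matrix.one_mulVec]

theorem M_symm (R : Mat) (v w : Vec) : v ⬝ᵥ (P.M R *ᵥ w) = w ⬝ᵥ (P.M R *ᵥ v) := by
  rw [Matrix.dotProduct_mulVec, ← Matrix.mulVec_transpose, P.M_transpose, dotProduct_comm]

/-- The derivative of the locked inertia matrix along `R' = R hat ω`. -/
def Mdot (R : Mat) (ω : Vec) : Mat :=
  (P.mT * P.r ^ 2) • ((hat (crossProduct (Gam R) ω))ᵀ * hat (Gam R)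
    + (hat (Gam R))ᵀ * hat (crossProduct (Gam R) ω))

theorem contDiff_Gam {n : WithTop ℕ∞} : ContDiff ℝ n Gam :=
  contDiff_id.matrix_transpose.matrix_mulVec contDiff_const

theorem contDiff_M {n : WithTop ℕ∞} : ContDiff ℝ n P.M :=
  contDiff_const.add
    ((contDiff_Gam.hat_comp.matrix_transpose.matrix_mul contDiff_Gam.hat_comp).const_smul _)

/-- `M` depends on the attitude only through `Γ`, and `Γ' = Γ × ω` because `e₃` is fixed in space.
-/
theorem hasDerivWithinAt_M {s : Set ℝ} {t : ℝ} {R : ℝ → Mat} {ω : Vec}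
    (hR : HasDerivWithinAt R (R t * hat ω) s t) :
    HasDerivWithinAt (fun τ => P.M (R τ)) (P.Mdot (R t) ω) s t := by
  have hG : HasDerivWithinAt (fun τ => Gam (R τ)) (crossProduct (Gam (R t)) ω) s t := by
    have h := hR.matrix_transpose.matrix_mulVec (hasDerivWithinAt_const t s (![0, 0, 1] : Vec))
    refine h.congr_deriv ?_
    rw [Matrix.mulVec_zero, add_zero, Matrix.transpose_mul, hat_transpose, ← Matrix.mulVec_mulVec,
      Matrix.neg_mulVec, hat_mulVec, cross_anticomm]
    rfl
  have h := (hG.hat_comp.matrix_transpose.matrix_mul hG.hat_comp).const_smul (P.mT * P.r ^ 2)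
  exact h.const_add _

/-- The state derivative under a rotor torque `u`. -/
noncomputable def forced (q : State) (u : Vec) : State :=
  let a : Vec := (P.M q.1)⁻¹ *ᵥ
    (crossProduct (Matrix.diagonal P.I *ᵥ q.2.1 + P.Ja • q.2.2) q.2.1 - u)
  (q.1 * hat q.2.1, a, P.Ja⁻¹ • u - a)

theorem sum_smul_mulVec_single (A : Mat) (u : Vec) :
    ∑ i, u i • (A *ᵥ Pi.single i 1) = A *ᵥ u := by
  ext j
  simp [Matrix.mulVec, dotProduct, mul_comm]

theorem sum_smul_single (u : Vec) : ∑ i, u i • (Pi.single i 1 : Vec) = u := by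
  simpa only [Matrix.one_mulVec] using sum_smul_mulVec_single 1 u

theorem drift_add_sum_smul_g (q : State) (u : Vec) :
    P.drift q + ∑ i, u i • P.g i q = P.forced q u := by
  refine Prod.ext ?_ (Prod.ext ?_ ?_)
  · simp [drift, forced, g, Prod.fst_sum]
  · simp only [drift, forced, g, Prod.snd_sum, Prod.fst_sum, Prod.snd_add, Prod.fst_add,
      Prod.smul_mk, smul_neg, Finset.sum_neg_distrib, sum_smul_mulVec_single, Matrix.mulVec_sub]
    rw [← sub_eq_add_neg]
  · simp only [drift, forced, g, Prod.snd_sum, Prod.snd_add,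
      Prod.smul_mk, smul_add, Finset.sum_add_distrib, sum_smul_mulVec_single, Matrix.mulVec_sub]
    simp only [smul_comm _ P.Ja⁻¹, ← Finset.smul_sum, sum_smul_single]
    abel

theorem Fcl_eq (lam : Vec) (fFF : FeedforwardLaw) (Rd : ℝ → Mat) (t : ℝ) (q : State) :
    P.Fcl lam fFF Rd t q = P.forced q (potentialDiff lam (Rd t) q.1
      - fFF (q.1, q.2.1, q.2.2, Rd t, desiredVelocity Rd t, deriv (desiredVelocity Rd) t)) :=
  P.drift_add_sum_smul_g q _

/-- `g_i` does not move the attitude, so `H` is a quadratic polynomial along the line in direction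
`g_i`. Its linear coefficient is `e ⬝ M w`, and `M w` is minus the `i`-th unit vector. -/
theorem lieG_eq (lam : Vec) (Rd : ℝ → Mat) (t : ℝ) (q : State) (i : Fin 3) :
    P.lieG lam Rd t q i = -velocityError Rd t q i := by
  set e := velocityError Rd t q with he
  set w : Vec := -((P.M q.1)⁻¹ *ᵥ Pi.single i 1) with hw
  have hMw : P.M q.1 *ᵥ w = -Pi.single i 1 := by
    rw [hw, Matrix.mulVec_neg, M_mulVec_inv]
  have hH : ∀ s : ℝ, P.H lam Rd t (q + s • P.g i q)
      = potential lam (Rd t) q.1 + 1 / 2 * (e ⬝ᵥ (P.M q.1 *ᵥ e))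
        + (s * (e ⬝ᵥ (P.M q.1 *ᵥ w)) + s ^ 2 * (1 / 2 * (w ⬝ᵥ (P.M q.1 *ᵥ w)))) := by
    intro s
    have h1 : (q + s • P.g i q).1 = q.1 := by simp [g]
    have h2 : velocityError Rd t (q + s • P.g i q) = e + s • w := by
      rw [he, velocityError, velocityError, h1]
      simp only [g, Prod.snd_add, Prod.fst_add, Prod.smul_mk, ← hw]
      abel
    rw [H, h1, h2]
    simp only [Matrix.mulVec_add, Matrix.mulVec_smul, dotProduct_add, add_dotProduct,
      smul_dotProduct, dotProduct_smul, smul_eq_mul, P.M_symm q.1 w e]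
    ring
  have hd : HasDerivAt (fun s : ℝ => P.H lam Rd t (q + s • P.g i q))
      (e ⬝ᵥ (P.M q.1 *ᵥ w)) 0 := by
    rw [funext hH]
    have h := (((hasDerivAt_id (0 : ℝ)).mul_const (e ⬝ᵥ (P.M q.1 *ᵥ w))).add
      ((hasDerivAt_pow 2 (0 : ℝ)).mul_const (1 / 2 * (w ⬝ᵥ (P.M q.1 *ᵥ w))))).const_add
      (potential lam (Rd t) q.1 + 1 / 2 * (e ⬝ᵥ (P.M q.1 *ᵥ e)))
    refine h.congr_deriv ?_
    simp
  rw [lieG, lineDeriv, hd.deriv, hMw, dotProduct_neg, dotProduct_single, mul_one]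

theorem uDiss_eq (lam : Vec) (Kv : ℝ) (Rd : ℝ → Mat) (t : ℝ) (q : State) :
    P.uDiss lam Kv Rd t q = Kv • velocityError Rd t q := by
  ext i
  simp [uDiss, lieG_eq]

theorem closedLoop_eq (lam : Vec) (Kv : ℝ) (fFF : FeedforwardLaw) (Rd : ℝ → Mat) (t : ℝ)
    (q : State) :
    P.closedLoop lam Kv fFF Rd t q = P.forced q (potentialDiff lam (Rd t) q.1
      - fFF (q.1, q.2.1, q.2.2, Rd t, desiredVelocity Rd t, deriv (desiredVelocity Rd) t)
      + Kv • velocityError Rd t q) := by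
  rw [closedLoop, Fcl, add_assoc, ← Finset.sum_add_distrib, uDiss_eq]
  simp only [← add_smul]
  exact P.drift_add_sum_smul_g q (_ + _)

theorem M_mulVec_forced (q : State) (u : Vec) : P.M q.1 *ᵥ (P.forced q u).2.1
    = crossProduct (Matrix.diagonal P.I *ᵥ q.2.1 + P.Ja • q.2.2) q.2.1 - u :=
  P.M_mulVec_inv _ _

theorem Ja_smul_forced (q : State) (u : Vec) :
    P.Ja • ((P.forced q u).2.1 + (P.forced q u).2.2) = u := by
  simp only [forced, add_sub_cancel, smul_smul, mul_inv_cancel₀ P.Ja_pos.ne', one_smul]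

end Robot

/-! ### Error kinematics and the derivative of `H`. -/

theorem desiredVelocity_contDiff {Rd : ℝ → Mat} (hRd2 : ContDiff ℝ 2 Rd) :
    ContDiff ℝ 1 (desiredVelocity Rd) := by
  have h1 : ContDiff ℝ 1 (deriv Rd) := by
    have : ContDiff ℝ (1 + 1) Rd := by simpa [one_add_one_eq_two] using hRd2
    exact (contDiff_succ_iff_deriv.1 this).2.2
  exact (((hRd2.of_le one_le_two).matrix_transpose).matrix_mul h1).vee_comp

theorem deriv_eq_mul_hat_desiredVelocity {Rd : ℝ → Mat} (hRd : ∀ t, Rd t ∈ SO3)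
    (hRd2 : ContDiff ℝ 2 Rd) (t : ℝ) : deriv Rd t = Rd t * hat (desiredVelocity Rd t) := by
  have hd := hRd2.differentiable two_ne_zero t
  have h1 := (hd.hasDerivAt.hasDerivWithinAt (s := univ)).matrix_transpose.matrix_mul
    (hd.hasDerivAt.hasDerivWithinAt (s := univ))
  simp only [fun τ => SO3.transpose_mul (hRd τ)] at h1
  have h2 : (deriv Rd t)ᵀ * Rd t + (Rd t)ᵀ * deriv Rd t = 0 :=
    (uniqueDiffWithinAt_univ (x := t)).eq_deriv _ h1 (hasDerivWithinAt_const t univ _)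
  rw [desiredVelocity, hat_vee, ← Matrix.mul_assoc, SO3.mul_transpose (hRd t), Matrix.one_mul]
  rw [Matrix.transpose_mul, Matrix.transpose_transpose]
  exact eq_neg_of_add_eq_zero_left h2

theorem hasDerivWithinAt_desired {Rd : ℝ → Mat} (hRd : ∀ t, Rd t ∈ SO3) (hRd2 : ContDiff ℝ 2 Rd)
    (s : Set ℝ) (t : ℝ) :
    HasDerivWithinAt Rd (Rd t * hat (desiredVelocity Rd t)) s t := by
  rw [← deriv_eq_mul_hat_desiredVelocity hRd hRd2]
  exact (hRd2.differentiable two_ne_zero t).hasDerivAt.hasDerivWithinAt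

/-- The derivative of `R_eᵀ ω_d` along `R_s' = R_s hat ω`, `R_d' = R_d hat ω_d`. -/
def transportedDot (Rd R : Mat) (ω ωd ωd' : Vec) : Vec :=
  transported Rd R ωd' - crossProduct ω (transported Rd R ωd)

section Derivatives

variable {Rd : ℝ → Mat} {s : Set ℝ} {t : ℝ} {q : ℝ → State} {q' : State}

theorem HasDerivWithinAt.attitude (h : HasDerivWithinAt q q' s t)
    (hq' : q'.1 = (q t).1 * hat (q t).2.1) :
    HasDerivWithinAt (fun τ => (q τ).1) ((q t).1 * hat (q t).2.1) s t := hq' ▸ h.fst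

theorem HasDerivWithinAt.velocity (h : HasDerivWithinAt q q' s t) :
    HasDerivWithinAt (fun τ => (q τ).2.1) q'.2.1 s t := h.snd.fst

/-- The transport `R_eᵀ ω_d` is what makes this work: `hat ω_d R_e = R_e hat (R_eᵀ ω_d)`, so both
velocities combine on the right into `hat e_ω`. -/
theorem hasDerivWithinAt_relative (hRd : ∀ t, Rd t ∈ SO3) (hRd2 : ContDiff ℝ 2 Rd)
    (h : HasDerivWithinAt q q' s t) (hR : (q t).1 ∈ SO3) (hq' : q'.1 = (q t).1 * hat (q t).2.1) :
    HasDerivWithinAt (fun τ => (Rd τ)ᵀ * (q τ).1)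
      ((Rd t)ᵀ * (q t).1 * hat (velocityError Rd t (q t))) s t := by
  have h1 := hasDerivWithinAt_desired hRd hRd2 s t
  refine (h1.matrix_transpose.matrix_mul (h.attitude hq')).congr_deriv ?_
  have h2 : ∀ v w : Vec, hat (v - w) = hat v - hat w := by
    intro v w
    ext i j
    fin_cases i <;> fin_cases j <;> simp [hat] <;> ring
  rw [velocityError, transported, h2, Matrix.mul_sub,
    SO3.mul_hat (SO3.transpose_mul_mem (hRd t) hR), Matrix.transpose_mul, hat_transpose,
    Matrix.neg_mul, Matrix.neg_mul]
  simp only [Matrix.mul_assoc]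
  abel

theorem hasDerivWithinAt_potential (lam : Vec) (hRd : ∀ t, Rd t ∈ SO3) (hRd2 : ContDiff ℝ 2 Rd)
    (h : HasDerivWithinAt q q' s t) (hR : (q t).1 ∈ SO3) (hq' : q'.1 = (q t).1 * hat (q t).2.1) :
    HasDerivWithinAt (fun τ => potential lam (Rd τ) (q τ).1)
      (potentialDiff lam (Rd t) (q t).1 ⬝ᵥ velocityError Rd t (q t)) s t := by
  have h1 := (hasDerivWithinAt_const t s (Matrix.diagonal lam)).matrix_mul
    ((hasDerivWithinAt_relative hRd hRd2 h hR hq').const_sub 1)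
  refine h1.matrix_trace.congr_deriv ?_
  rw [potentialDiff, ← neg_trace_mul_hat, Matrix.zero_mul, zero_add, Matrix.mul_neg,
    Matrix.trace_neg, ← Matrix.mul_assoc]

theorem hasDerivWithinAt_velocityError (hRd : ∀ t, Rd t ∈ SO3) (hRd2 : ContDiff ℝ 2 Rd)
    (h : HasDerivWithinAt q q' s t) (hq' : q'.1 = (q t).1 * hat (q t).2.1) :
    HasDerivWithinAt (fun τ => velocityError Rd τ (q τ))
      (q'.2.1 - transportedDot (Rd t) (q t).1 (q t).2.1 (desiredVelocity Rd t)
        (deriv (desiredVelocity Rd) t)) s t := by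
  have h1 := hasDerivWithinAt_desired hRd hRd2 s t
  have hω := ((desiredVelocity_contDiff hRd2).differentiable one_ne_zero t).hasDerivAt
  have h2 := ((h1.matrix_transpose.matrix_mul (h.attitude hq')).matrix_transpose.matrix_mulVec
    hω.hasDerivWithinAt)
  refine (h.velocity.sub h2).congr_deriv ?_
  simp only [transportedDot, transported, Matrix.transpose_add, Matrix.transpose_mul,
    Matrix.transpose_transpose, Matrix.transpose_neg, Matrix.add_mulVec, hat_transpose, Matrix.neg_mul,
    Matrix.neg_mulVec, ← Matrix.mulVec_mulVec, hat_mulVec, cross_self, neg_zero,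
    Matrix.mulVec_zero]
  abel

theorem Robot.hasDerivWithinAt_H (P : Robot) (lam : Vec) (hRd : ∀ t, Rd t ∈ SO3)
    (hRd2 : ContDiff ℝ 2 Rd)
    (h : HasDerivWithinAt q q' s t) (hR : (q t).1 ∈ SO3) (hq' : q'.1 = (q t).1 * hat (q t).2.1) :
    HasDerivWithinAt (fun τ => P.H lam Rd τ (q τ))
      (potentialDiff lam (Rd t) (q t).1 ⬝ᵥ velocityError Rd t (q t)
        + velocityError Rd t (q t) ⬝ᵥ (P.M (q t).1 *ᵥ q'.2.1
          - P.M (q t).1 *ᵥ transportedDot (Rd t) (q t).1 (q t).2.1 (desiredVelocity Rd t)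
              (deriv (desiredVelocity Rd) t)
          + (1 / 2 : ℝ) • (P.Mdot (q t).1 (q t).2.1 *ᵥ velocityError Rd t (q t)))) s t := by
  have he := hasDerivWithinAt_velocityError hRd hRd2 h hq'
  have h1 := (hasDerivWithinAt_potential lam hRd hRd2 h hR hq').add
    ((he.vec_dotProduct ((P.hasDerivWithinAt_M (h.attitude hq')).matrix_mulVec he)).const_mul
      (1 / 2))
  refine h1.congr_deriv ?_
  simp only [dotProduct_add, dotProduct_smul, ← Matrix.mulVec_sub, smul_eq_mul]
  rw [P.M_symm _ (velocityError Rd t (q t))]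
  ring

end Derivatives

/-! ### The residual torque and the power balance. -/

/-- The arguments of a feedforward law. -/
abbrev LawData : Type := Mat × Vec × Vec × Mat × Vec × Vec

/-- The arguments of the feedforward law at time `t` in the state `q`. -/
noncomputable def lawData (Rd : ℝ → Mat) (t : ℝ) (q : State) : LawData :=
  (q.1, q.2.1, q.2.2, Rd t, desiredVelocity Rd t, deriv (desiredVelocity Rd) t)

theorem contDiff_transported {n : WithTop ℕ∞} {E : Type*} [NormedAddCommGroup E] [NormedSpace ℝ E]
    {Rd R : E → Mat} {ωd : E → Vec} (hRd : ContDiff ℝ n Rd) (hR : ContDiff ℝ n R)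
    (hω : ContDiff ℝ n ωd) : ContDiff ℝ n fun x => transported (Rd x) (R x) (ωd x) :=
  (hRd.matrix_transpose.matrix_mul hR).matrix_transpose.matrix_mulVec hω

theorem contDiff_transportedDot {n : WithTop ℕ∞} {E : Type*} [NormedAddCommGroup E]
    [NormedSpace ℝ E] {Rd R : E → Mat} {ω ωd ωd' : E → Vec} (hRd : ContDiff ℝ n Rd)
    (hR : ContDiff ℝ n R) (hω : ContDiff ℝ n ω) (hωd : ContDiff ℝ n ωd)
    (hωd' : ContDiff ℝ n ωd') :
    ContDiff ℝ n fun x => transportedDot (Rd x) (R x) (ω x) (ωd x) (ωd' x) :=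
  (contDiff_transported hRd hR hωd').sub (hω.vec_cross (contDiff_transported hRd hR hωd))

theorem contDiff_potentialDiff {n : WithTop ℕ∞} {E : Type*} [NormedAddCommGroup E]
    [NormedSpace ℝ E] (lam : Vec) {Rd R : E → Mat} (hRd : ContDiff ℝ n Rd)
    (hR : ContDiff ℝ n R) : ContDiff ℝ n fun x => potentialDiff lam (Rd x) (R x) := by
  have h : ContDiff ℝ n fun x => Matrix.diagonal lam * ((Rd x)ᵀ * R x) :=
    contDiff_const.matrix_mul (hRd.matrix_transpose.matrix_mul hR)
  exact (h.sub h.matrix_transpose).vee_comp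

namespace Robot

variable (P : Robot)

/-- The gyroscopic torque `(I^s ω + J Θ') × ω`. -/
def gyro (ω Θ : Vec) : Vec := crossProduct (Matrix.diagonal P.I *ᵥ ω + P.Ja • Θ) ω

theorem contDiff_gyro {n : WithTop ℕ∞} {E : Type*} [NormedAddCommGroup E] [NormedSpace ℝ E]
    {ω Θ : E → Vec} (hω : ContDiff ℝ n ω) (hΘ : ContDiff ℝ n Θ) :
    ContDiff ℝ n fun x => P.gyro (ω x) (Θ x) :=
  ((contDiff_const.matrix_mulVec hω).add (hΘ.const_smul _)).vec_cross hω

/-- The rate of change of `M e_ω`, up to the terms contributed by `-dV` and `u_diss`. -/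
noncomputable def residual (fFF : FeedforwardLaw) (y : LawData) : Vec :=
  P.gyro y.2.1 y.2.2.1 + fFF y
    - P.M y.1 *ᵥ transportedDot y.2.2.2.1 y.1 y.2.1 y.2.2.2.2.1 y.2.2.2.2.2
    + P.Mdot y.1 y.2.1 *ᵥ (y.2.1 - transported y.2.2.2.1 y.1 y.2.2.2.2.1)

theorem contDiff_Mdot {n : WithTop ℕ∞} {E : Type*} [NormedAddCommGroup E] [NormedSpace ℝ E]
    {R : E → Mat} {ω : E → Vec} (hR : ContDiff ℝ n R) (hω : ContDiff ℝ n ω) :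
    ContDiff ℝ n fun x => P.Mdot (R x) (ω x) := by
  have hG : ContDiff ℝ n fun x => Gam (R x) := contDiff_Gam.comp hR
  have hG' := (hG.vec_cross hω).hat_comp
  exact ((hG'.matrix_transpose.matrix_mul hG.hat_comp).add
    (hG.hat_comp.matrix_transpose.matrix_mul hG')).const_smul _

theorem contDiff_residual {fFF : FeedforwardLaw} (h : ContDiff ℝ 1 fFF) :
    ContDiff ℝ 1 (P.residual fFF) := by
  have h1 : ContDiff ℝ 1 fun y : LawData => y.1 := contDiff_fst
  have h2 : ContDiff ℝ 1 fun y : LawData => y.2.1 := contDiff_snd.fst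
  have h3 : ContDiff ℝ 1 fun y : LawData => y.2.2.1 := contDiff_snd.snd.fst
  have h4 : ContDiff ℝ 1 fun y : LawData => y.2.2.2.1 := contDiff_snd.snd.snd.fst
  have h5 : ContDiff ℝ 1 fun y : LawData => y.2.2.2.2.1 := contDiff_snd.snd.snd.snd.fst
  have h6 : ContDiff ℝ 1 fun y : LawData => y.2.2.2.2.2 := contDiff_snd.snd.snd.snd.snd
  exact (((P.contDiff_gyro h2 h3).add h).sub
    ((P.contDiff_M.comp h1).matrix_mulVec (contDiff_transportedDot h4 h1 h2 h5 h6))).add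
    ((P.contDiff_Mdot h1 h2).matrix_mulVec (h2.sub (contDiff_transported h4 h1 h5)))

/-- The leading `M` cancels the `M⁻¹` in the connection, leaving a polynomial expression. -/
theorem contDiff_feedforward {n : WithTop ℕ∞} : ContDiff ℝ n P.feedforward := by
  have h1 : ContDiff ℝ n fun y : LawData => y.1 := contDiff_fst
  have h2 : ContDiff ℝ n fun y : LawData => y.2.1 := contDiff_snd.fst
  have h4 : ContDiff ℝ n fun y : LawData => y.2.2.2.1 := contDiff_snd.snd.snd.fst
  have h5 : ContDiff ℝ n fun y : LawData => y.2.2.2.2.1 := contDiff_snd.snd.snd.snd.fst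
  have h6 : ContDiff ℝ n fun y : LawData => y.2.2.2.2.2 := contDiff_snd.snd.snd.snd.snd
  have hM : ContDiff ℝ n fun y : LawData => P.M y.1 := P.contDiff_M.comp h1
  have hη := contDiff_transported h4 h1 h5
  have hη' := contDiff_transported h4 h1 h6
  have h := (hM.matrix_mulVec ((h2.vec_cross hη).add hη')).add
    (((h2.vec_cross (hM.matrix_mulVec hη)).const_smul (1 / 2 : ℝ)).add
      ((hη.vec_cross (hM.matrix_mulVec h2)).const_smul (1 / 2 : ℝ)))
  convert h using 1
  funext y
  simp only [feedforward, connection, Matrix.mulVec_add _ (_ + _), M_mulVec_inv]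

/-- The energy rate of the undamped closed loop is `e_ω ⬝ (Y - ½ M' e_ω)`, `Y` the residual. -/
theorem lieDeriv_Fcl_eq (lam : Vec) {Rd : ℝ → Mat} (hRd : ∀ t, Rd t ∈ SO3)
    (hRd2 : ContDiff ℝ 2 Rd) (fFF : FeedforwardLaw) (t : ℝ) {q : State} (hq : q.1 ∈ SO3) :
    lieDeriv (P.Fcl lam fFF Rd) (P.H lam Rd) t q
      = velocityError Rd t q ⬝ᵥ (P.residual fFF (lawData Rd t q)
          - (1 / 2 : ℝ) • (P.Mdot q.1 q.2.1 *ᵥ velocityError Rd t q)) := by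
  set F := P.Fcl lam fFF Rd t q with hF
  -- This straight line leaves `SO(3)`, but the formula for the derivative of `H` needs only the
  -- position and velocity at time `t`.
  have hγ : HasDerivWithinAt (fun τ : ℝ => q + (τ - t) • F) F univ t := by
    have h := (((hasDerivAt_id t).sub_const t).smul_const F).const_add q
    rw [one_smul] at h
    exact h.hasDerivWithinAt
  have hγt : q + (t - t) • F = q := by rw [sub_self, zero_smul, add_zero]
  have h := P.hasDerivWithinAt_H lam hRd hRd2 hγ (by rw [hγt]; exact hq)
    (by rw [hγt, hF, Fcl_eq]; rfl)
  rw [hγt, hasDerivWithinAt_univ] at h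
  have h' := HasDerivAt.comp_const_add t 0 (by rw [add_zero]; exact h)
  simp only [add_sub_cancel_left] at h'
  rw [lieDeriv, ← hF, h'.deriv, hF, Fcl_eq, M_mulVec_forced]
  rw [dotProduct_comm, ← dotProduct_add]
  congr 1
  simp only [residual, lawData, gyro]
  rw [show q.2.1 - transported (Rd t) q.1 (desiredVelocity Rd t) = velocityError Rd t q from rfl]
  module

section Power

variable {P} {lam : Vec} {Rd : ℝ → Mat} {fFF : FeedforwardLaw}

theorem residual_power (hRd : ∀ t, Rd t ∈ SO3) (hRd2 : ContDiff ℝ 2 Rd)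
    (hL : ∀ t : ℝ, 0 ≤ t → ∀ q : State, q.1 ∈ SO3 →
      lieDeriv (P.Fcl lam fFF Rd) (P.H lam Rd) t q = 0)
    {t : ℝ} (ht : 0 ≤ t) {q : State} (hq : q.1 ∈ SO3) :
    velocityError Rd t q ⬝ᵥ (P.residual fFF (lawData Rd t q)
      - (1 / 2 : ℝ) • (P.Mdot q.1 q.2.1 *ᵥ velocityError Rd t q)) = 0 := by
  rw [← P.lieDeriv_Fcl_eq lam hRd hRd2 fFF t hq]
  exact hL t ht q hq

/-- Put `e = s v` in the power identity and divide by `s ≠ 0`. By continuity the quotient also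
vanishes at `s = 0`, where the `M'` terms drop out, so the residual is orthogonal to every `v`. -/
theorem residual_eq_zero (hf : ContDiff ℝ 1 fFF)
    {t : ℝ} {R : Mat} {Θ : Vec}
    (hpow : ∀ ω : Vec, velocityError Rd t (R, ω, Θ) ⬝ᵥ
      (P.residual fFF (lawData Rd t (R, ω, Θ))
        - (1 / 2 : ℝ) • (P.Mdot R ω *ᵥ velocityError Rd t (R, ω, Θ))) = 0) :
    P.residual fFF (lawData Rd t
      (R, transported (Rd t) R (desiredVelocity Rd t), Θ)) = 0 := by
  set η := transported (Rd t) R (desiredVelocity Rd t) with hη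
  have key : ∀ v : Vec, v ⬝ᵥ P.residual fFF (lawData Rd t (R, η, Θ)) = 0 := by
    intro v
    let φ : ℝ → ℝ := fun s => v ⬝ᵥ (P.residual fFF (lawData Rd t (R, η + s • v, Θ))
      - (1 / 2 : ℝ) • (P.Mdot R (η + s • v) *ᵥ (s • v)))
    have hlin : ContDiff ℝ 1 fun s : ℝ => η + s • v :=
      contDiff_const.add (contDiff_id.smul contDiff_const)
    have hdat : ContDiff ℝ 1 fun s : ℝ => lawData Rd t (R, η + s • v, Θ) :=
      contDiff_const.prodMk (hlin.prodMk (contDiff_const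
        (c := (Θ, Rd t, desiredVelocity Rd t, deriv (desiredVelocity Rd) t))))
    have hφ : Continuous φ :=
      (contDiff_const.vec_dotProduct ((((P.contDiff_residual hf).comp hdat)).sub
        (((P.contDiff_Mdot contDiff_const hlin).matrix_mulVec
          (contDiff_id.smul contDiff_const)).const_smul (1 / 2 : ℝ)))).continuous
    have h0 : ∀ s : ℝ, s ≠ 0 → φ s = 0 := by
      intro s hs
      have h := hpow (η + s • v)
      have he : velocityError Rd t (R, η + s • v, Θ) = s • v := by
        simp only [velocityError, ← hη, add_sub_cancel_left]
      rw [he, smul_dotProduct, smul_eq_mul] at h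
      exact (mul_eq_zero.1 h).resolve_left hs
    have h1 : φ 0 = 0 := by
      have hz : Tendsto φ (𝓝[≠] 0) (𝓝 0) :=
        tendsto_const_nhds.congr' (by
          filter_upwards [self_mem_nhdsWithin] with s hs
          exact (h0 s hs).symm)
      exact tendsto_nhds_unique (hφ.continuousAt.mono_left nhdsWithin_le_nhds) hz
    simpa [φ] using h1
  exact dotProduct_self_eq_zero.1 (key _)

/-- This feedforward ignores the rotor rates while the gyroscopic torque does not. Comparing rotor
rates `Θ` and `0` at `R_s = R_d` leaves `(ω - ω_d) ⬝ (Θ × ω) = 0`, hence `ω_d ⬝ (Θ × ω) = 0` for all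
`Θ`, `ω`. -/
theorem desiredVelocity_eq_zero_of_feedforward (hRd : ∀ t, Rd t ∈ SO3)
    (hRd2 : ContDiff ℝ 2 Rd)
    (hL : ∀ t : ℝ, 0 ≤ t → ∀ q : State, q.1 ∈ SO3 →
      lieDeriv (P.Fcl lam P.feedforward Rd) (P.H lam Rd) t q = 0)
    {t : ℝ} (ht : 0 ≤ t) : desiredVelocity Rd t = 0 := by
  have key : ∀ ω Θ : Vec, desiredVelocity Rd t ⬝ᵥ crossProduct Θ ω = 0 := by
    intro ω Θ
    have h1 := residual_power hRd hRd2 hL ht (q := (Rd t, ω, Θ)) (hRd t)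
    have h2 := residual_power hRd hRd2 hL ht (q := (Rd t, ω, 0)) (hRd t)
    have he : ∀ Θ' : Vec, velocityError Rd t (Rd t, ω, Θ') = ω - desiredVelocity Rd t := by
      intro Θ'
      simp [velocityError, transported, SO3.transpose_mul (hRd t)]
    have hr : P.residual P.feedforward (lawData Rd t (Rd t, ω, Θ))
        = P.residual P.feedforward (lawData Rd t (Rd t, ω, 0))
          + P.Ja • crossProduct Θ ω := by
      simp only [residual, lawData, feedforward, gyro, map_add, map_smul, LinearMap.add_apply,
        LinearMap.smul_apply, smul_zero, add_zero]
      abel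
    simp only [he, hr] at h1 h2
    have h3 : (ω - desiredVelocity Rd t) ⬝ᵥ (P.Ja • crossProduct Θ ω) = 0 := by
      simp only [dotProduct_add, dotProduct_sub] at h1 h2 ⊢
      linarith
    have h4 : ω ⬝ᵥ crossProduct Θ ω = 0 := by
      simp [cross_apply, dotProduct, Fin.sum_univ_three]; ring
    rw [dotProduct_smul, smul_eq_mul, sub_dotProduct, h4, zero_sub] at h3
    have h5 := (mul_eq_zero.1 h3).resolve_left P.Ja_pos.ne'
    linarith
  ext i
  have h0 := key ![0, 0, 1] ![0, 1, 0]
  have h1 := key ![1, 0, 0] ![0, 0, 1]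
  have h2 := key ![0, 1, 0] ![1, 0, 0]
  simp [cross_apply, dotProduct, Fin.sum_univ_three] at h0 h1 h2
  fin_cases i <;> simpa

theorem feedforward_bounded (hRd : ∀ t, Rd t ∈ SO3) (hRd2 : ContDiff ℝ 2 Rd)
    (hL : ∀ t : ℝ, 0 ≤ t → ∀ q : State, q.1 ∈ SO3 →
      lieDeriv (P.Fcl lam P.feedforward Rd) (P.H lam Rd) t q = 0) :
    ∀ t : ℝ, 0 ≤ t → ‖desiredVelocity Rd t‖ ≤ 0 ∧ ‖deriv (desiredVelocity Rd) t‖ ≤ 0 := by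
  intro t ht
  have hz : ∀ τ ∈ Ici (0 : ℝ), desiredVelocity Rd τ = 0 := fun τ hτ =>
    desiredVelocity_eq_zero_of_feedforward hRd hRd2 hL hτ
  have h1 := ((desiredVelocity_contDiff hRd2).differentiable one_ne_zero t).hasDerivAt
  have h2 : HasDerivWithinAt (desiredVelocity Rd) 0 (Ici 0) t :=
    (hasDerivWithinAt_const t (Ici 0) (0 : Vec)).congr hz (hz t ht)
  -- At `t = 0` the vanishing is known on one side only. Since `ω_d` is differentiable, its
  -- one-sided derivative determines the full one.
  have h3 := (uniqueDiffOn_Ici (0 : ℝ) t ht).eq_deriv _ h1.hasDerivWithinAt h2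
  rw [hz t ht, h3, norm_zero]
  exact ⟨le_rfl, le_rfl⟩

theorem hasDerivWithinAt_H_closedLoop {Kv : ℝ} (hRd : ∀ t, Rd t ∈ SO3) (hRd2 : ContDiff ℝ 2 Rd)
    (hL : ∀ t : ℝ, 0 ≤ t → ∀ q : State, q.1 ∈ SO3 →
      lieDeriv (P.Fcl lam fFF Rd) (P.H lam Rd) t q = 0)
    {s : Set ℝ} {t : ℝ} (ht : 0 ≤ t) {q : ℝ → State} (hq : (q t).1 ∈ SO3)
    (h : HasDerivWithinAt q (P.closedLoop lam Kv fFF Rd t (q t)) s t) :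
    HasDerivWithinAt (fun τ => P.H lam Rd τ (q τ))
      (-(Kv * (velocityError Rd t (q t) ⬝ᵥ velocityError Rd t (q t)))) s t := by
  rw [closedLoop_eq] at h
  refine (P.hasDerivWithinAt_H lam hRd hRd2 h hq rfl).congr_deriv ?_
  have hp := residual_power hRd hRd2 hL ht hq
  rw [M_mulVec_forced]
  simp only [residual, lawData, gyro] at hp
  rw [show (q t).2.1 - transported (Rd t) (q t).1 (desiredVelocity Rd t)
    = velocityError Rd t (q t) from rfl] at hp
  simp only [dotProduct_add, dotProduct_sub, dotProduct_smul, smul_eq_mul] at hp ⊢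
  rw [dotProduct_comm (potentialDiff lam (Rd t) (q t).1)]
  linarith

end Power

/-! ### Conservation of angular momentum. -/

/-- The angular momentum about the contact point, in the sphere frame. -/
def momentum (q : State) : Vec := P.M q.1 *ᵥ q.2.1 + P.Ja • (q.2.1 + q.2.2)

/-- The rotor torque is internal and cancels between the two equations of motion. The gyroscopic
terms cancel against `ω × p`, with `p` the momentum. What remains, `M' ω` and the rolling part of `ω
× M ω`, cancels by the Jacobi identity, for any `Γ`. -/
theorem hasDerivWithinAt_momentum {s : Set ℝ} {t : ℝ} {q : ℝ → State} {u : Vec}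
    (h : HasDerivWithinAt q (P.forced (q t) u) s t) :
    HasDerivWithinAt (fun τ => (q τ).1 *ᵥ P.momentum (q τ)) 0 s t := by
  have hR := h.attitude rfl
  have hp : HasDerivWithinAt (fun τ => P.momentum (q τ)) _ s t :=
    ((P.hasDerivWithinAt_M hR).matrix_mulVec h.velocity).add
      ((h.velocity.add h.snd.snd).const_smul P.Ja)
  refine (hR.matrix_mulVec hp).congr_deriv ?_
  rw [Ja_smul_forced, M_mulVec_forced, ← Matrix.mulVec_mulVec, ← Matrix.mulVec_add]
  refine Eq.trans (congrArg ((q t).1 *ᵥ ·) ?_) (Matrix.mulVec_zero (q t).1)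
  simp only [momentum, M, Mdot, Matrix.add_mulVec, Matrix.smul_mulVec, ← Matrix.mulVec_mulVec,
    hat_transpose, Matrix.neg_mulVec, hat_mulVec]
  generalize Gam (q t).1 = G
  ext i
  fin_cases i <;>
    simp [cross_apply, Matrix.mulVec_diagonal, vecHead, vecTail] <;> ring

end Robot

/-! ### Estimates in the sup norm; the factors `3` count coordinates. -/

theorem abs_dotProduct_le (v w : Vec) : |v ⬝ᵥ w| ≤ 3 * ‖v‖ * ‖w‖ := by
  calc |v ⬝ᵥ w| ≤ ∑ i, |v i * w i| := Finset.abs_sum_le_sum_abs _ _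
    _ ≤ ∑ _i : Fin 3, ‖v‖ * ‖w‖ := by
        gcongr with i
        rw [abs_mul]
        exact mul_le_mul (norm_le_pi_norm v i) (norm_le_pi_norm w i) (abs_nonneg _) (norm_nonneg _)
    _ = 3 * ‖v‖ * ‖w‖ := by simp; ring

theorem sq_norm_le_dotProduct_self (v : Vec) : ‖v‖ ^ 2 ≤ v ⬝ᵥ v := by
  have hn : 0 ≤ v ⬝ᵥ v := dotProduct_self_star_nonneg v
  have h : ‖v‖ ≤ √(v ⬝ᵥ v) := by
    rw [pi_norm_le_iff_of_nonneg (Real.sqrt_nonneg _)]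
    intro i
    rw [Real.norm_eq_abs]
    refine Real.abs_le_sqrt ?_
    rw [sq]
    exact Finset.single_le_sum (f := fun i => v i * v i) (fun i _ => mul_self_nonneg _)
      (Finset.mem_univ i)
  calc ‖v‖ ^ 2 ≤ √(v ⬝ᵥ v) ^ 2 := by gcongr
    _ = _ := Real.sq_sqrt hn

theorem norm_mulVec_le (A : Mat) (v : Vec) : ‖A *ᵥ v‖ ≤ 3 * ‖A‖ * ‖v‖ := by
  rw [pi_norm_le_iff_of_nonneg (by positivity)]
  intro i
  refine (abs_dotProduct_le (A i) v).trans ?_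
  gcongr
  rw [pi_norm_le_iff_of_nonneg (norm_nonneg _)]
  exact fun j => Matrix.norm_entry_le_entrywise_sup_norm A

theorem norm_matrix_mul_le (A B : Mat) : ‖A * B‖ ≤ 3 * ‖A‖ * ‖B‖ := by
  rw [Matrix.norm_le_iff (by positivity)]
  intro i j
  refine (abs_dotProduct_le (A i) (fun k => B k j)).trans ?_
  gcongr
  · rw [pi_norm_le_iff_of_nonneg (norm_nonneg _)]
    exact fun j => Matrix.norm_entry_le_entrywise_sup_norm A
  · rw [pi_norm_le_iff_of_nonneg (norm_nonneg _)]
    exact fun j => Matrix.norm_entry_le_entrywise_sup_norm B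

theorem norm_hat_le (v : Vec) : ‖hat v‖ ≤ ‖v‖ := by
  rw [Matrix.norm_le_iff (norm_nonneg _)]
  have h := norm_le_pi_norm v
  intro i j
  fin_cases i <;> fin_cases j <;> simp [hat, -Real.norm_eq_abs, h]

theorem norm_vee_sub_transpose_le (A : Mat) : ‖vee (A - Aᵀ)‖ ≤ 2 * ‖A‖ := by
  have h : ∀ i j, ‖A i j‖ ≤ ‖A‖ := fun i j => Matrix.norm_entry_le_entrywise_sup_norm A
  have h' : ∀ i j k l, ‖A i j - A k l‖ ≤ 2 * ‖A‖ := fun i j k l =>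
    (norm_sub_le _ _).trans (by linarith [h i j, h k l])
  rw [pi_norm_le_iff_of_nonneg (by positivity)]
  intro i
  fin_cases i
  exacts [h' 2 1 1 2, h' 0 2 2 0, h' 1 0 0 1]

theorem SO3.norm_le_one {R : Mat} (h : R ∈ SO3) : ‖R‖ ≤ 1 := by
  rw [Matrix.norm_le_iff zero_le_one]
  intro i j
  have h1 : ∑ k, R i k * R i k = 1 := by
    have := congrFun (congrFun (SO3.mul_transpose h) i) i
    simpa [Matrix.mul_apply] using this
  rw [Real.norm_eq_abs, ← Real.sqrt_one]
  refine Real.abs_le_sqrt ?_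
  rw [sq, ← h1]
  exact Finset.single_le_sum (f := fun k => R i k * R i k) (fun k _ => mul_self_nonneg _)
    (Finset.mem_univ j)

theorem SO3.one_mem : (1 : Mat) ∈ SO3 := mem_SO3_of (by simp) (by simp)

theorem SO3.diag_le_one {Q : Mat} (h : Q ∈ SO3) (i : Fin 3) : Q i i ≤ 1 :=
  (le_abs_self _).trans
    ((Matrix.norm_entry_le_entrywise_sup_norm Q (i := i) (j := i)).trans (SO3.norm_le_one h))

/-- For rotations the squared Frobenius distance is `6 - 2 tr (Qᵀ R)`, and it dominates the squared
sup norm. -/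
theorem SO3.sq_norm_sub_le {Q R : Mat} (hQ : Q ∈ SO3) (hR : R ∈ SO3) :
    ‖R - Q‖ ^ 2 ≤ 2 * ∑ i, (1 - (Qᵀ * R) i i) := by
  have htr : ∑ i, ∑ j, (R i j - Q i j) ^ 2 = 2 * ∑ i, (1 - (Qᵀ * R) i i) := by
    have h1 : (R * Rᵀ).trace = 3 := by rw [SO3.mul_transpose hR]; simp
    have h2 : (Q * Qᵀ).trace = 3 := by rw [SO3.mul_transpose hQ]; simp
    simp only [Matrix.trace, Matrix.diag, Matrix.mul_apply, Matrix.transpose_apply,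
      Fin.sum_univ_three] at h1 h2 ⊢
    linarith
  have hle : ‖R - Q‖ ≤ √(∑ i, ∑ j, (R i j - Q i j) ^ 2) := by
    rw [Matrix.norm_le_iff (Real.sqrt_nonneg _)]
    intro i j
    refine Real.abs_le_sqrt ?_
    exact (Finset.single_le_sum (f := fun j => (R i j - Q i j) ^ 2) (fun k _ => sq_nonneg _)
      (Finset.mem_univ j)).trans (Finset.single_le_sum
        (f := fun i => ∑ j, (R i j - Q i j) ^ 2)
        (fun k _ => Finset.sum_nonneg fun _ _ => sq_nonneg _) (Finset.mem_univ i))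
  calc ‖R - Q‖ ^ 2 ≤ √(∑ i, ∑ j, (R i j - Q i j) ^ 2) ^ 2 := by gcongr
    _ = _ := by
      rw [Real.sq_sqrt (Finset.sum_nonneg fun _ _ => Finset.sum_nonneg fun _ _ => sq_nonneg _), htr]

theorem potential_eq (lam : Vec) (Rd R : Mat) :
    potential lam Rd R = ∑ i, lam i * (1 - (Rdᵀ * R) i i) := by
  simp [potential, Matrix.trace, Matrix.diagonal_mul]

theorem exists_pos_le (a : Vec) (h : ∀ i, 0 < a i) : ∃ l > 0, ∀ i, l ≤ a i :=
  ⟨Finset.univ.inf' Finset.univ_nonempty a,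
    (Finset.lt_inf'_iff _).2 fun i _ => h i, fun i => Finset.inf'_le _ (Finset.mem_univ i)⟩

/-! ### The trace potential near the desired attitude. -/

section Potential

variable {lam : Vec} {l : ℝ} {Rd R : Mat}

theorem sum_one_sub_diag_le_potential (hl : ∀ i, l ≤ lam i) (hRd : Rd ∈ SO3) (hR : R ∈ SO3) :
    l * ∑ i, (1 - (Rdᵀ * R) i i) ≤ potential lam Rd R := by
  rw [potential_eq, Finset.mul_sum]
  gcongr with i
  · linarith [SO3.diag_le_one (SO3.transpose_mul_mem hRd hR) i]
  · exact hl i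

theorem sum_one_sub_diag_nonneg (hRd : Rd ∈ SO3) (hR : R ∈ SO3) :
    0 ≤ ∑ i, (1 - (Rdᵀ * R) i i) :=
  Finset.sum_nonneg fun i _ => by linarith [SO3.diag_le_one (SO3.transpose_mul_mem hRd hR) i]

theorem potential_nonneg (hl : ∀ i, 0 < lam i) (hRd : Rd ∈ SO3) (hR : R ∈ SO3) :
    0 ≤ potential lam Rd R := by
  simpa using sum_one_sub_diag_le_potential (l := 0) (fun i => (hl i).le) hRd hR

theorem sq_norm_sub_le_potential (hl : ∀ i, l ≤ lam i) (hRd : Rd ∈ SO3) (hR : R ∈ SO3)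
    (hl0 : 0 < l) : l * ‖R - Rd‖ ^ 2 ≤ 2 * potential lam Rd R := by
  have h1 := SO3.sq_norm_sub_le hRd hR
  have h2 := sum_one_sub_diag_le_potential hl hRd hR
  nlinarith

theorem sq_norm_relative_sub_le_potential (hl : ∀ i, l ≤ lam i) (hRd : Rd ∈ SO3) (hR : R ∈ SO3)
    (hl0 : 0 < l) : l * ‖Rdᵀ * R - 1‖ ^ 2 ≤ 2 * potential lam Rd R := by
  have h1 := SO3.sq_norm_sub_le SO3.one_mem (SO3.transpose_mul_mem hRd hR)
  rw [Matrix.transpose_one, Matrix.one_mul] at h1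
  have h2 := sum_one_sub_diag_le_potential hl hRd hR
  nlinarith

/-- Twice the axial vector of the relative attitude. -/
def attitudeError (Rd R : Mat) : Vec := vee (Rdᵀ * R - (Rdᵀ * R)ᵀ)

theorem sq_norm_attitudeError_le (hl : ∀ i, l ≤ lam i) (hRd : Rd ∈ SO3) (hR : R ∈ SO3)
    (hl0 : 0 < l) : l * ‖attitudeError Rd R‖ ^ 2 ≤ 8 * potential lam Rd R := by
  have h1 : ‖attitudeError Rd R‖ ≤ 2 * ‖Rdᵀ * R - 1‖ := by
    have h := norm_vee_sub_transpose_le (Rdᵀ * R - 1)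
    rwa [Matrix.transpose_sub, Matrix.transpose_one, sub_sub_sub_cancel_right] at h
  have h2 := sq_norm_relative_sub_le_potential hl hRd hR hl0
  have h3 : ‖attitudeError Rd R‖ ^ 2 ≤ (2 * ‖Rdᵀ * R - 1‖) ^ 2 := by gcongr
  nlinarith

/-- This is the coercivity behind convergence: the differential of `V` has a component along the
attitude error proportional to `V` itself. Both sides are linear in `lam`. The coefficient of `lam
i` needs only that row `i` is a unit vector and that the other two diagonal entries equal their
cofactors. -/
theorem attitudeError_dotProduct_potentialDiff (hRd : Rd ∈ SO3) (hR : R ∈ SO3) :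
    attitudeError Rd R ⬝ᵥ potentialDiff lam Rd R
      = (1 + (Rdᵀ * R).trace) * potential lam Rd R := by
  rw [potential_eq]
  unfold attitudeError potentialDiff
  have hQ := SO3.transpose_mul_mem hRd hR
  generalize Rdᵀ * R = Q at hQ
  have ha : ∀ i j, Q.adjugate i j = Q j i := fun i j => congrFun (congrFun (SO3.adjugate_eq hQ) i) j
  have hr : ∀ i, Q i 0 * Q i 0 + Q i 1 * Q i 1 + Q i 2 * Q i 2 = 1 := fun i => by
    have := congrFun (congrFun (SO3.mul_transpose hQ) i) i
    simpa [Matrix.mul_apply, Fin.sum_univ_three] using this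
  have a0 := ha 0 0
  have a1 := ha 1 1
  have a2 := ha 2 2
  simp [Matrix.adjugate_fin_three] at a0 a1 a2
  have r0 := hr 0
  have r1 := hr 1
  have r2 := hr 2
  simp [vee, Matrix.diagonal_mul, Matrix.trace, dotProduct, Fin.sum_univ_three]
  linear_combination lam 0 * (r0 + a1 + a2) + lam 1 * (r1 + a0 + a2) + lam 2 * (r2 + a0 + a1)

end Potential

/-! ### Comparison of `H` with distances to the desired motion. -/

namespace Robot

variable (P : Robot)

theorem exists_norm_M_le : ∃ C > 0, ∀ R ∈ SO3, ‖P.M R‖ ≤ C := by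
  obtain ⟨C, hC⟩ := (isCompact_closedBall (0 : Mat) 1).exists_bound_of_continuousOn
    (P.contDiff_M (n := 0)).continuous.continuousOn
  refine ⟨max C 1, by positivity, fun R hR => (hC R ?_).trans (le_max_left _ _)⟩
  simpa using SO3.norm_le_one hR

theorem le_dotProduct_M {m : ℝ} (hm : ∀ i, m ≤ P.I i) (R : Mat) (v : Vec) :
    m * (v ⬝ᵥ v) ≤ v ⬝ᵥ (P.M R *ᵥ v) := by
  have h1 : v ⬝ᵥ (P.M R *ᵥ v) = v ⬝ᵥ (Matrix.diagonal P.I *ᵥ v)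
      + P.mT * P.r ^ 2 * ((hat (Gam R) *ᵥ v) ⬝ᵥ (hat (Gam R) *ᵥ v)) := by
    rw [M, Matrix.add_mulVec, dotProduct_add, Matrix.smul_mulVec, dotProduct_smul, smul_eq_mul,
      ← Matrix.mulVec_mulVec, Matrix.dotProduct_mulVec _ (hat (Gam R))ᵀ, Matrix.vecMul_transpose]
  have h2 : m * (v ⬝ᵥ v) ≤ v ⬝ᵥ (Matrix.diagonal P.I *ᵥ v) := by
    simp only [dotProduct, Matrix.mulVec_diagonal, Finset.mul_sum]
    refine Finset.sum_le_sum fun i _ => ?_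
    nlinarith [hm i, mul_self_nonneg (v i)]
  have h3 : 0 ≤ (hat (Gam R) *ᵥ v) ⬝ᵥ (hat (Gam R) *ᵥ v) := dotProduct_self_star_nonneg _
  have := P.mT_pos
  rw [h1]
  have : 0 ≤ P.mT * P.r ^ 2 * ((hat (Gam R) *ᵥ v) ⬝ᵥ (hat (Gam R) *ᵥ v)) := by positivity
  linarith

variable {lam : Vec} {Rd : ℝ → Mat} {t : ℝ} {q : State}

theorem le_H {m : ℝ} (hm : ∀ i, m ≤ P.I i) (hm0 : 0 < m) :
    potential lam (Rd t) q.1 + m / 2 * ‖velocityError Rd t q‖ ^ 2 ≤ P.H lam Rd t q := by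
  have h1 := P.le_dotProduct_M hm q.1 (velocityError Rd t q)
  have h2 := sq_norm_le_dotProduct_self (velocityError Rd t q)
  rw [H]
  nlinarith

theorem H_le {C : ℝ} (hC : ‖P.M q.1‖ ≤ C) :
    P.H lam Rd t q ≤ potential lam (Rd t) q.1 + 9 / 2 * C * ‖velocityError Rd t q‖ ^ 2 := by
  set e := velocityError Rd t q with he
  have h1 := (le_abs_self _).trans (abs_dotProduct_le e (P.M q.1 *ᵥ e))
  have h2 := norm_mulVec_le (P.M q.1) e
  have h3 : 3 * ‖e‖ * ‖P.M q.1 *ᵥ e‖ ≤ 3 * ‖e‖ * (3 * C * ‖e‖) := by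
    gcongr
    exact h2.trans (by gcongr)
  rw [H, ← he]
  nlinarith

theorem H_nonneg (hlam : ∀ i, 0 < lam i) (hRd : Rd t ∈ SO3) (hq : q.1 ∈ SO3) :
    0 ≤ P.H lam Rd t q := by
  obtain ⟨m, hm0, hm⟩ := exists_pos_le P.I P.I_pos
  have h1 := P.le_H hm hm0 (lam := lam) (Rd := Rd) (t := t) (q := q)
  have h2 := potential_nonneg hlam hRd hq
  have : 0 ≤ m / 2 * ‖velocityError Rd t q‖ ^ 2 := by positivity
  linarith

/-- The threshold is uniform in `t` thanks to the bound on `ω_d`, which enters through `ω_s - ω_d =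
e_ω + (R_e - 1)ᵀ ω_d`. -/
theorem near_of_H_lt (hlam : ∀ i, 0 < lam i) (hRd : ∀ t, Rd t ∈ SO3) {B : ℝ}
    (hB : ∀ t, 0 ≤ t → ‖desiredVelocity Rd t‖ ≤ B) {ε : ℝ} (hε : 0 < ε) :
    ∃ h > 0, ∀ t, 0 ≤ t → ∀ q : State, q.1 ∈ SO3 → P.H lam Rd t q < h →
      Near (Rd t) (desiredVelocity Rd t) ε q := by
  have hB0 : 0 ≤ B := (norm_nonneg _).trans (hB 0 le_rfl)
  obtain ⟨m, hm0, hm⟩ := exists_pos_le P.I P.I_pos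
  obtain ⟨l, hl0, hl⟩ := exists_pos_le lam hlam
  -- With `e_ω` and `R_e - 1` both smaller than `a`, the velocity deviation is below `a + 3 a B =
  -- ε`.
  set a : ℝ := ε / (1 + 3 * B) with ha
  have ha0 : 0 < a := by positivity
  have haB : a * (1 + 3 * B) = ε := by rw [ha]; field_simp
  refine ⟨min (l * a ^ 2 / 2) (m * a ^ 2 / 2), by positivity, fun t ht q hq hH => ?_⟩
  have hH1 := hH.trans_le (min_le_left _ _)
  have hH2 := hH.trans_le (min_le_right _ _)
  have hle := P.le_H hm hm0 (lam := lam) (Rd := Rd) (t := t) (q := q)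
  have hV0 := potential_nonneg hlam (hRd t) hq
  have hV : potential lam (Rd t) q.1 < l * a ^ 2 / 2 := by
    have : 0 ≤ m / 2 * ‖velocityError Rd t q‖ ^ 2 := by positivity
    linarith
  have he : ‖velocityError Rd t q‖ < a := by
    refine lt_of_pow_lt_pow_left₀ 2 ha0.le ?_
    nlinarith
  have hR : ‖q.1 - Rd t‖ < a := by
    refine lt_of_pow_lt_pow_left₀ 2 ha0.le ?_
    nlinarith [sq_norm_sub_le_potential hl (hRd t) hq hl0]
  have hQ : ‖(Rd t)ᵀ * q.1 - 1‖ < a := by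
    refine lt_of_pow_lt_pow_left₀ 2 ha0.le ?_
    nlinarith [sq_norm_relative_sub_le_potential hl (hRd t) hq hl0]
  refine ⟨by nlinarith, ?_⟩
  have hω : q.2.1 - desiredVelocity Rd t = velocityError Rd t q
      + ((Rd t)ᵀ * q.1 - 1)ᵀ *ᵥ desiredVelocity Rd t := by
    rw [velocityError, transported, Matrix.transpose_sub, Matrix.sub_mulVec, Matrix.transpose_one,
      Matrix.one_mulVec]
    abel
  have h3 := norm_mulVec_le ((Rd t)ᵀ * q.1 - 1)ᵀ (desiredVelocity Rd t)
  rw [Matrix.norm_transpose] at h3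
  have h4 : 3 * ‖(Rd t)ᵀ * q.1 - 1‖ * ‖desiredVelocity Rd t‖ ≤ 3 * a * B := by
    gcongr
    exact hB t ht
  have h5 := norm_add_le (velocityError Rd t q)
    (((Rd t)ᵀ * q.1 - 1)ᵀ *ᵥ desiredVelocity Rd t)
  rw [hω]
  linarith

/-- `H` does not involve the rotor rates, so they may be set to `0` and continuity in `(R_s, ω_s)`
gives a `δ` independent of them. -/
theorem H_lt_of_near (hRd : ∀ t, Rd t ∈ SO3) (t : ℝ) {h : ℝ} (hh : 0 < h) :
    ∃ δ > 0, ∀ q : State, Near (Rd t) (desiredVelocity Rd t) δ q → P.H lam Rd t q < h := by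
  let ψ : Mat × Vec → ℝ := fun x => P.H lam Rd t (x.1, x.2, 0)
  have he : ContDiff ℝ 0 fun x : Mat × Vec => velocityError Rd t (x.1, x.2, 0) :=
    contDiff_snd.sub (contDiff_transported contDiff_const contDiff_fst contDiff_const)
  have hψ : Continuous ψ := by
    have h1 : ContDiff ℝ 0 ψ :=
      (contDiff_const.matrix_mul (contDiff_const.sub
        (contDiff_const.matrix_mul contDiff_fst))).matrix_trace.add
        (contDiff_const.mul (he.vec_dotProduct ((P.contDiff_M.comp contDiff_fst).matrix_mulVec he)))
    exact h1.continuous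
  have h0 : ψ (Rd t, desiredVelocity Rd t) = 0 := by
    simp [ψ, H, potential, velocityError, transported, SO3.transpose_mul (hRd t)]
  obtain ⟨δ, hδ, hball⟩ := Metric.continuousAt_iff.1
    (hψ.continuousAt (x := (Rd t, desiredVelocity Rd t))) h hh
  refine ⟨δ, hδ, fun q hq => ?_⟩
  have h1 := hball (x := (q.1, q.2.1)) (by
    rw [dist_eq_norm]
    exact max_lt hq.1 hq.2)
  rw [h0, Real.dist_eq, sub_zero] at h1
  exact (le_abs_self _).trans_lt h1

end Robot

/-! ### Global solutions of ordinary differential equations. -/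

section ODE

variable {E : Type*} [NormedAddCommGroup E] [NormedSpace ℝ E]

theorem HasDerivWithinAt.Icc_to_Ici {f : ℝ → E} {f' : E} {a b t : ℝ}
    (h : HasDerivWithinAt f f' (Icc a b) t) (ht : t < b) : HasDerivWithinAt f f' (Ici a) t :=
  h.mono_of_mem_nhdsWithin (mem_of_superset (inter_mem_nhdsWithin (Ici a) (Iio_mem_nhds ht))
    fun _ hs => ⟨hs.1, le_of_lt hs.2⟩)

/-- A bounded field cannot leave a ball of radius `L (n + 1)` within time `n + 1`, so
Picard–Lindelöf applies on intervals of every length. Uniqueness makes these solutions agree, and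
they are glued along `⌈s - t₀⌉₊`. -/
theorem exists_solution_Ici [CompleteSpace E] {v : ℝ → E → E} {K L : NNReal}
    (hK : ∀ t, LipschitzWith K (v t)) (hv : ∀ x, Continuous fun t => v t x)
    (hL : ∀ t x, ‖v t x‖ ≤ L) (t₀ : ℝ) (x₀ : E) :
    ∃ q : ℝ → E, q t₀ = x₀ ∧ ∀ t ∈ Ici t₀, HasDerivWithinAt q (v t (q t)) (Ici t₀) t := by
  have hex : ∀ n : ℕ, ∃ α : ℝ → E, α t₀ = x₀ ∧
      ∀ t ∈ Icc t₀ (t₀ + (n + 1)),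
        HasDerivWithinAt α (v t (α t)) (Icc t₀ (t₀ + (n + 1))) t := by
    intro n
    have hn : (0 : ℝ) ≤ n + 1 := by positivity
    have hpl : IsPicardLindelof v (tmin := t₀) (tmax := t₀ + (n + 1))
        ⟨t₀, by simpa using hn⟩ x₀ (L * (n + 1)) 0 L K :=
      { lipschitzOnWith := fun t _ => (hK t).lipschitzOnWith
        continuousOn := fun x _ => (hv x).continuousOn
        norm_le := fun t _ x _ => hL t x
        mul_max_le := by simp [hn] }
    exact hpl.exists_eq_forall_mem_Icc_hasDerivWithinAt₀
  choose α hα0 hα using hex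
  have huniq : ∀ k n : ℕ, ∀ s, t₀ ≤ s → s ≤ t₀ + (k + 1) → s ≤ t₀ + (n + 1) →
      α k s = α n s := by
    intro k n s hs hk hn
    have hsub : ∀ j : ℕ, s ≤ t₀ + (j + 1) → ContinuousOn (α j) (Icc t₀ s) ∧
        ∀ τ ∈ Ico t₀ s, HasDerivWithinAt (α j) (v τ (α j τ)) (Ici τ) τ := by
      intro j hj
      refine ⟨fun τ hτ => ((hα j τ ⟨hτ.1, hτ.2.trans hj⟩).continuousWithinAt).mono
        (Icc_subset_Icc_right hj), fun τ hτ => ?_⟩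
      exact ((hα j τ ⟨hτ.1, hτ.2.le.trans hj⟩).Icc_to_Ici (hτ.2.trans_le hj)).mono
        (Ici_subset_Ici.2 hτ.1)
    exact ODE_solution_unique hK (hsub k hk).1 (hsub k hk).2 (hsub n hn).1 (hsub n hn).2
      ((hα0 k).trans (hα0 n).symm) ⟨hs, le_rfl⟩
  have hceil : ∀ s, s ≤ t₀ + (⌈s - t₀⌉₊ + 1) := fun s => by linarith [Nat.le_ceil (s - t₀)]
  refine ⟨fun s => α ⌈s - t₀⌉₊ s, hα0 _, fun t ht => ?_⟩
  -- The extra `+ 1` in the interval length keeps `t` strictly left of its right end, so the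
  -- derivative passes to `Ici t₀`.
  have ht' : t < t₀ + (⌈t - t₀⌉₊ + 1) := by linarith [Nat.le_ceil (t - t₀)]
  have h := hα ⌈t - t₀⌉₊ t ⟨ht, ht'.le⟩
  exact (h.congr (fun s hs => huniq _ _ s hs.1 (hceil s) hs.2) rfl).Icc_to_Ici ht'

/-- Solve the tame field `w` globally. At the first time the norm reaches `ρ`, the curve has so far
been a solution for `v`, and the a priori bound says its norm is still below `ρ`. -/
theorem exists_solution_Ici_of_confined [CompleteSpace E] {v w : ℝ → E → E} {K L : NNReal}
    (hK : ∀ t, LipschitzWith K (w t)) (hw : ∀ x, Continuous fun t => w t x)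
    (hL : ∀ t x, ‖w t x‖ ≤ L) {t₀ ρ : ℝ} {x₀ : E}
    (heq : ∀ t, t₀ ≤ t → ∀ x, ‖x‖ ≤ ρ → w t x = v t x) (hx₀ : ‖x₀‖ < ρ)
    (hconf : ∀ t₁, t₀ ≤ t₁ → ∀ q : ℝ → E, q t₀ = x₀ →
      (∀ t ∈ Icc t₀ t₁, HasDerivWithinAt q (v t (q t)) (Icc t₀ t₁) t) → ‖q t₁‖ < ρ) :
    ∃ q : ℝ → E, q t₀ = x₀ ∧ ∀ t ∈ Ici t₀, HasDerivWithinAt q (v t (q t)) (Ici t₀) t := by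
  obtain ⟨q, hq0, hq⟩ := exists_solution_Ici hK hw hL t₀ x₀
  have hcont : ContinuousOn (fun t => ‖q t‖) (Ici t₀) := fun t ht =>
    (hq t ht).continuousWithinAt.norm
  have hlt : ∀ t, t₀ ≤ t → ‖q t‖ < ρ := by
    by_contra! hcon
    obtain ⟨t, ht, htρ⟩ := hcon
    let S : Set ℝ := {s | t₀ ≤ s ∧ ‖q s‖ = ρ}
    have hivt : ∀ s, t₀ ≤ s → ρ ≤ ‖q s‖ → ∃ s' ∈ S, s' ≤ s := by
      intro s hs hsρ
      obtain ⟨s', hs', he⟩ := intermediate_value_Icc hs (hcont.mono Icc_subset_Ici_self)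
        ⟨(by simpa only [hq0] using hx₀.le : ‖q t₀‖ ≤ ρ), hsρ⟩
      exact ⟨s', ⟨hs'.1, he⟩, hs'.2⟩
    have hSne : S.Nonempty := let ⟨s', hs', _⟩ := hivt t ht htρ; ⟨s', hs'⟩
    have hSbdd : BddBelow S := ⟨t₀, fun s hs => hs.1⟩
    have hScl : IsClosed S :=
      hcont.preimage_isClosed_of_isClosed isClosed_Ici (isClosed_singleton (x := ρ))
    have ht₁ := hScl.csInf_mem hSne hSbdd
    set t₁ := sInf S with ht₁def
    have hle : ∀ s ∈ Icc t₀ t₁, ‖q s‖ ≤ ρ := by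
      intro s hs
      by_contra! hgt
      obtain ⟨s', hs', hs's⟩ := hivt s hs.1 hgt.le
      have h1 : s = t₁ := le_antisymm hs.2 ((csInf_le hSbdd hs').trans hs's)
      rw [h1, ht₁.2] at hgt
      exact lt_irrefl _ hgt
    refine (hconf t₁ ht₁.1 q hq0 fun s hs => ?_).ne ht₁.2
    rw [← heq s hs.1 _ (hle s hs)]
    exact (hq s hs.1).mono Icc_subset_Ici_self
  refine ⟨q, hq0, fun t ht => ?_⟩
  rw [← heq t ht _ (hlt t ht).le]
  exact hq t ht

theorem eq_of_hasDerivWithinAt_zero {f : ℝ → E} {a b : ℝ}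
    (h : ∀ t ∈ Icc a b, HasDerivWithinAt f 0 (Icc a b) t) : ∀ t ∈ Icc a b, f t = f a := by
  refine constant_of_derivWithin_zero (fun t ht => (h t ht).differentiableWithinAt)
    fun t ht => ?_
  exact (h t (Ico_subset_Icc_self ht)).derivWithin
    (uniqueDiffOn_Icc (ht.1.trans_lt ht.2) t (Ico_subset_Icc_self ht))

end ODE

/-- `R Rᵀ` is constant because `hat ω` is skew, and the determinant is constant because `hat ω` has
trace zero. -/
theorem SO3.mem_of_hasDerivWithinAt {R : ℝ → Mat} {ω : ℝ → Vec} {a b : ℝ}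
    (h : ∀ t ∈ Icc a b, HasDerivWithinAt R (R t * hat (ω t)) (Icc a b) t) (ha : R a ∈ SO3) :
    ∀ t ∈ Icc a b, R t ∈ SO3 := by
  have h1 : ∀ t ∈ Icc a b, R t * (R t)ᵀ = 1 := by
    intro t ht
    have hc := eq_of_hasDerivWithinAt_zero (f := fun τ => R τ * (R τ)ᵀ) (a := a) (b := b)
      (fun τ hτ => ((h τ hτ).matrix_mul (h τ hτ).matrix_transpose).congr_deriv (by
        rw [Matrix.transpose_mul, hat_transpose, Matrix.neg_mul, Matrix.mul_neg,
          ← Matrix.mul_assoc, add_neg_cancel])) t ht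
    exact hc.trans (SO3.mul_transpose ha)
  have h2 : ∀ t ∈ Icc a b, HasDerivWithinAt (fun τ => (R τ).det) 0 (Icc a b) t := by
    intro t ht
    have he := hasDerivWithinAt_matrix.1 (h t ht)
    simp only [Matrix.det_fin_three]
    refine ((((((((he 0 0).mul (he 1 1)).mul (he 2 2)).sub
      (((he 0 0).mul (he 1 2)).mul (he 2 1))).sub
      (((he 0 1).mul (he 1 0)).mul (he 2 2))).add
      (((he 0 1).mul (he 1 2)).mul (he 2 0))).add
      (((he 0 2).mul (he 1 0)).mul (he 2 1))).sub
      (((he 0 2).mul (he 1 1)).mul (he 2 0))).congr_deriv ?_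
    simp [hat, Matrix.mul_apply, Fin.sum_univ_three]
    ring
  intro t ht
  exact mem_SO3_of (h1 t ht) ((eq_of_hasDerivWithinAt_zero h2 t ht).trans (SO3.det_eq_one ha))

theorem IsTrajectoryOn.mono {F : ℝ → State → State} {s s' : Set ℝ} {q : ℝ → State}
    (h : IsTrajectoryOn F s q) (hs : s' ⊆ s) : IsTrajectoryOn F s' q :=
  fun t ht => ⟨(h t (hs ht)).1, (h t (hs ht)).2.mono hs⟩

theorem antitoneOn_of_hasDerivWithinAt_self {D : Set ℝ} (hD : Convex ℝ D) {f f' : ℝ → ℝ}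
    (hf : ∀ t ∈ D, HasDerivWithinAt f (f' t) D t) (hf' : ∀ t ∈ D, f' t ≤ 0) : AntitoneOn f D :=
  antitoneOn_of_hasDerivWithinAt_nonpos hD (fun t ht => (hf t ht).continuousWithinAt)
    (fun t ht => (hf t (interior_subset ht)).mono interior_subset)
    fun t ht => hf' t (interior_subset ht)

theorem norm_transported_le {Rd R : Mat} (hRd : Rd ∈ SO3) (hR : R ∈ SO3) (w : Vec) :
    ‖transported Rd R w‖ ≤ 3 * ‖w‖ := by
  refine (norm_mulVec_le _ w).trans ?_
  have h := SO3.norm_le_one (SO3.transpose_mul_mem hRd hR)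
  rw [Matrix.norm_transpose]
  have := norm_nonneg w
  nlinarith

theorem lipschitzWith_lawData (Rd : ℝ → Mat) (t : ℝ) : LipschitzWith 1 (lawData Rd t) := by
  refine LipschitzWith.of_dist_le_mul fun x y => ?_
  simp [lawData, Prod.dist_eq]

theorem continuous_lawData {Rd : ℝ → Mat} (hRd2 : ContDiff ℝ 2 Rd) (q : State) :
    Continuous fun t => lawData Rd t q := by
  have h := desiredVelocity_contDiff hRd2
  exact continuous_const.prodMk (continuous_const.prodMk (continuous_const.prodMk
    (hRd2.continuous.prodMk (h.continuous.prodMk (h.continuous_deriv le_rfl)))))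

theorem norm_lawData_le {Rd : ℝ → Mat} (hRd : ∀ t, Rd t ∈ SO3) {B ρ : ℝ} {t : ℝ}
    (hB : ‖desiredVelocity Rd t‖ ≤ B ∧ ‖deriv (desiredVelocity Rd) t‖ ≤ B) {q : State}
    (hq : ‖q‖ ≤ ρ) : ‖lawData Rd t q‖ ≤ max (max ρ 1) B := by
  have h1 : ‖q.1‖ ≤ ρ := (norm_fst_le q).trans hq
  have h2 : ‖q.2.1‖ ≤ ρ := (norm_fst_le q.2).trans ((norm_snd_le q).trans hq)
  have h3 : ‖q.2.2‖ ≤ ρ := (norm_snd_le q.2).trans ((norm_snd_le q).trans hq)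
  have h4 := SO3.norm_le_one (hRd t)
  simp only [lawData, Prod.norm_mk, max_le_iff]
  refine ⟨?_, ?_, ?_, ?_, ?_, ?_⟩
  · exact h1.trans ((le_max_left _ _).trans (le_max_left _ _))
  · exact h2.trans ((le_max_left _ _).trans (le_max_left _ _))
  · exact h3.trans ((le_max_left _ _).trans (le_max_left _ _))
  · exact h4.trans ((le_max_right _ _).trans (le_max_left _ _))
  · exact hB.1.trans (le_max_right _ _)
  · exact hB.2.trans (le_max_right _ _)

/-! ### A priori bounds and existence of closed-loop trajectories. -/

namespace Robot

variable (P : Robot)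

/-- The closed-loop vector field as a function of the arguments of the feedforward law. -/
noncomputable def closedLoopField (lam : Vec) (Kv : ℝ) (fFF : FeedforwardLaw) (y : LawData) :
    State :=
  P.forced (y.1, y.2.1, y.2.2.1) (potentialDiff lam y.2.2.2.1 y.1 - fFF y
    + Kv • (y.2.1 - transported y.2.2.2.1 y.1 y.2.2.2.2.1))

theorem closedLoop_eq_field (lam : Vec) (Kv : ℝ) (fFF : FeedforwardLaw) (Rd : ℝ → Mat) (t : ℝ)
    (q : State) :
    P.closedLoop lam Kv fFF Rd t q = P.closedLoopField lam Kv fFF (lawData Rd t q) :=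
  P.closedLoop_eq lam Kv fFF Rd t q

theorem contDiff_closedLoopField (lam : Vec) (Kv : ℝ) {fFF : FeedforwardLaw}
    (h : ContDiff ℝ 1 fFF) : ContDiff ℝ 1 (P.closedLoopField lam Kv fFF) := by
  have h1 : ContDiff ℝ 1 fun y : LawData => y.1 := contDiff_fst
  have h2 : ContDiff ℝ 1 fun y : LawData => y.2.1 := contDiff_snd.fst
  have h3 : ContDiff ℝ 1 fun y : LawData => y.2.2.1 := contDiff_snd.snd.fst
  have h4 : ContDiff ℝ 1 fun y : LawData => y.2.2.2.1 := contDiff_snd.snd.snd.fst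
  have h5 : ContDiff ℝ 1 fun y : LawData => y.2.2.2.2.1 := contDiff_snd.snd.snd.snd.fst
  have hu := ((contDiff_potentialDiff lam h4 h1).sub h).add
    ((h2.sub (contDiff_transported h4 h1 h5)).const_smul Kv)
  have ha := ((P.contDiff_M.comp h1).matrix_inv fun y => P.M_det_ne_zero y.1).matrix_mulVec
    ((P.contDiff_gyro h2 h3).sub hu)
  exact (h1.matrix_mul h2.hat_comp).prodMk (ha.prodMk ((hu.const_smul P.Ja⁻¹).sub ha))

variable {P} {lam : Vec} {Kv : ℝ} {Rd : ℝ → Mat} {fFF : FeedforwardLaw}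

theorem antitoneOn_H (hKv : 0 < Kv) (hRd : ∀ t, Rd t ∈ SO3) (hRd2 : ContDiff ℝ 2 Rd)
    (hL : ∀ t : ℝ, 0 ≤ t → ∀ q : State, q.1 ∈ SO3 →
      lieDeriv (P.Fcl lam fFF Rd) (P.H lam Rd) t q = 0)
    {s : Set ℝ} (hs : Convex ℝ s) (hs0 : s ⊆ Ici 0) {q : ℝ → State}
    (hq : IsTrajectoryOn (P.closedLoop lam Kv fFF Rd) s q) :
    AntitoneOn (fun t => P.H lam Rd t (q t)) s :=
  antitoneOn_of_hasDerivWithinAt_self hs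
    (fun t ht => hasDerivWithinAt_H_closedLoop hRd hRd2 hL (hs0 ht) (hq t ht).1 (hq t ht).2)
    fun _ _ => neg_nonpos.2 (mul_nonneg hKv.le (dotProduct_self_star_nonneg _))

/-- Conservation of the angular momentum bounds the rotor rates. -/
theorem exists_state_bound (hlam : ∀ i, 0 < lam i) (hKv : 0 < Kv) (hRd : ∀ t, Rd t ∈ SO3)
    (hRd2 : ContDiff ℝ 2 Rd) {B : ℝ} (hB : ∀ t, 0 ≤ t → ‖desiredVelocity Rd t‖ ≤ B)
    (hL : ∀ t : ℝ, 0 ≤ t → ∀ q : State, q.1 ∈ SO3 →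
      lieDeriv (P.Fcl lam fFF Rd) (P.H lam Rd) t q = 0)
    {t₀ : ℝ} (ht₀ : 0 ≤ t₀) {x₀ : State} (hx₀ : x₀.1 ∈ SO3) :
    ∃ ρ, ‖x₀‖ < ρ ∧ ∀ t₁, t₀ ≤ t₁ → ∀ q : ℝ → State, q t₀ = x₀ →
      IsTrajectoryOn (P.closedLoop lam Kv fFF Rd) (Icc t₀ t₁) q → ‖q t₁‖ < ρ := by
  have hB0 : 0 ≤ B := (norm_nonneg _).trans (hB 0 le_rfl)
  obtain ⟨m, hm0, hm⟩ := exists_pos_le P.I P.I_pos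
  obtain ⟨C, hC0, hC⟩ := P.exists_norm_M_le
  have hJ := P.Ja_pos
  set h₀ := P.H lam Rd t₀ x₀ with hh₀
  have hh₀0 : 0 ≤ h₀ := P.H_nonneg hlam (hRd t₀) hx₀
  -- `w`, `p` and `θ` will bound the angular velocity, the momentum and the rotor rates: `H ≤ h₀`
  -- controls `e_ω`, conservation controls the momentum, and solving the momentum for `Θ'` gives
  -- `θ`.
  set w := √(2 * h₀ / m) + 3 * B with hw
  have hw0 : 0 ≤ w := by positivity
  set p := 3 * ‖x₀.1 *ᵥ P.momentum x₀‖ with hp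
  set θ := (p + 3 * C * w) / P.Ja + w with hθ
  have hθ0 : 0 ≤ θ := by positivity
  refine ⟨‖x₀‖ + (1 + w + θ), by linarith, fun t₁ ht₁ q hq0 hq => ?_⟩
  have hmem : t₁ ∈ Icc t₀ t₁ := ⟨ht₁, le_rfl⟩
  have hR := (hq t₁ hmem).1
  have hH : P.H lam Rd t₁ (q t₁) ≤ h₀ := by
    have := antitoneOn_H hKv hRd hRd2 hL (convex_Icc t₀ t₁) (fun t ht => ht₀.trans ht.1) hq
      ⟨le_rfl, ht₁⟩ hmem ht₁
    simpa only [hq0] using this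
  have he : ‖velocityError Rd t₁ (q t₁)‖ ≤ √(2 * h₀ / m) := by
    refine Real.le_sqrt_of_sq_le ?_
    rw [le_div_iff₀ hm0]
    have h1 := P.le_H hm hm0 (lam := lam) (Rd := Rd) (t := t₁) (q := q t₁)
    have h2 := potential_nonneg hlam (hRd t₁) hR
    nlinarith
  have hω : ‖(q t₁).2.1‖ ≤ w := by
    have h1 : (q t₁).2.1 = velocityError Rd t₁ (q t₁)
        + transported (Rd t₁) (q t₁).1 (desiredVelocity Rd t₁) := by
      rw [velocityError, sub_add_cancel]
    have h2 := norm_transported_le (hRd t₁) hR (desiredVelocity Rd t₁)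
    have h3 := hB t₁ (ht₀.trans ht₁)
    rw [h1]
    refine (norm_add_le _ _).trans ?_
    linarith
  have hmom : ‖P.momentum (q t₁)‖ ≤ p := by
    have h1 : (q t₁).1 *ᵥ P.momentum (q t₁) = x₀.1 *ᵥ P.momentum x₀ := by
      rw [← hq0]
      refine eq_of_hasDerivWithinAt_zero (f := fun τ => (q τ).1 *ᵥ P.momentum (q τ))
        (a := t₀) (b := t₁) (fun t ht => ?_) t₁ hmem
      have h := (hq t ht).2
      rw [closedLoop_eq] at h
      exact P.hasDerivWithinAt_momentum h
    have h2 : P.momentum (q t₁) = (q t₁).1ᵀ *ᵥ (x₀.1 *ᵥ P.momentum x₀) := by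
      rw [← h1, Matrix.mulVec_mulVec, SO3.transpose_mul hR, Matrix.one_mulVec]
    rw [h2]
    refine (norm_mulVec_le _ _).trans ?_
    rw [Matrix.norm_transpose, hp]
    have := SO3.norm_le_one hR
    have := norm_nonneg (x₀.1 *ᵥ P.momentum x₀)
    nlinarith
  have hΘ : ‖(q t₁).2.2‖ ≤ θ := by
    have h1 : (q t₁).2.2 = P.Ja⁻¹ • (P.momentum (q t₁) - P.M (q t₁).1 *ᵥ (q t₁).2.1)
        - (q t₁).2.1 := by
      rw [momentum, add_sub_cancel_left, smul_smul, inv_mul_cancel₀ hJ.ne', one_smul,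
        add_sub_cancel_left]
    have h2 : ‖P.M (q t₁).1 *ᵥ (q t₁).2.1‖ ≤ 3 * C * w :=
      (norm_mulVec_le _ _).trans (by gcongr; exact hC _ hR)
    rw [h1, hθ, div_eq_inv_mul]
    refine (norm_sub_le _ _).trans (add_le_add ?_ hω)
    rw [norm_smul, Real.norm_eq_abs, abs_of_pos (inv_pos.2 hJ)]
    gcongr
    exact (norm_sub_le _ _).trans (add_le_add hmom h2)
  have hR1 := SO3.norm_le_one hR
  have hx := norm_nonneg x₀
  refine (max_le (c := 1 + w + θ) (by linarith) (max_le (by linarith) (by linarith))).trans_lt ?_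
  -- Strictness comes from `‖x₀‖ > 0`, which holds because a rotation is not the zero matrix.
  by_cases hx' : ‖x₀‖ = 0
  · exact absurd (SO3.transpose_mul hx₀) (by
      rw [norm_eq_zero.1 hx']; simp)
  · have := lt_of_le_of_ne hx (Ne.symm hx')
    linarith

/-- The closed-loop field is autonomous and `C¹` in the law data. A cutoff makes it globally
Lipschitz and bounded without changing it where `exists_state_bound` confines the solutions. -/
theorem exists_trajectory (hlam : ∀ i, 0 < lam i) (hKv : 0 < Kv) (hRd : ∀ t, Rd t ∈ SO3)
    (hRd2 : ContDiff ℝ 2 Rd) (hf : ContDiff ℝ 1 fFF) {B : ℝ}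
    (hB : ∀ t, 0 ≤ t → ‖desiredVelocity Rd t‖ ≤ B ∧ ‖deriv (desiredVelocity Rd) t‖ ≤ B)
    (hL : ∀ t : ℝ, 0 ≤ t → ∀ q : State, q.1 ∈ SO3 →
      lieDeriv (P.Fcl lam fFF Rd) (P.H lam Rd) t q = 0)
    {t₀ : ℝ} (ht₀ : 0 ≤ t₀) {x₀ : State} (hx₀ : x₀.1 ∈ SO3) :
    ∃ q : ℝ → State, IsTrajectoryOn (P.closedLoop lam Kv fFF Rd) (Ici t₀) q ∧ q t₀ = x₀ := by
  have hso : ∀ t₁, ∀ q : ℝ → State, q t₀ = x₀ → (∀ t ∈ Icc t₀ t₁,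
      HasDerivWithinAt q (P.closedLoop lam Kv fFF Rd t (q t)) (Icc t₀ t₁) t) →
      ∀ t ∈ Icc t₀ t₁, (q t).1 ∈ SO3 := by
    intro t₁ q hq0 hq
    refine SO3.mem_of_hasDerivWithinAt (R := fun t => (q t).1) (ω := fun t => (q t).2.1)
      (fun t ht => ?_) (by simpa only [hq0] using hx₀)
    have h := hq t ht
    rw [closedLoop_eq] at h
    exact h.attitude rfl
  obtain ⟨ρ, hρ, hbound⟩ := exists_state_bound hlam hKv hRd hRd2 (fun t ht => (hB t ht).1) hL ht₀ hx₀
  set r := max (max ρ 1) B with hr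
  have hr0 : 0 < r := lt_of_lt_of_le one_pos ((le_max_right _ _).trans (le_max_left _ _))
  -- The radius `r` covers the law data of every state with `‖x‖ ≤ ρ` at every `t ≥ t₀`; this uses
  -- the bounds on `ω_d` and its derivative.
  let χ : ContDiffBump (0 : LawData) := ⟨r, r + 1, hr0, lt_add_one r⟩
  let G : LawData → State := fun y => χ y • P.closedLoopField lam Kv fFF y
  have hG : ContDiff ℝ 1 G := χ.contDiff.smul (P.contDiff_closedLoopField lam Kv hf)
  have hGc : HasCompactSupport G := χ.hasCompactSupport.smul_right
  obtain ⟨K, hK⟩ := hG.lipschitzWith_of_hasCompactSupport hGc one_ne_zero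
  obtain ⟨L, hLb⟩ := hGc.exists_bound_of_continuous hG.continuous
  obtain ⟨q, hq0, hq⟩ := exists_solution_Ici_of_confined (v := P.closedLoop lam Kv fFF Rd)
    (w := fun t x => G (lawData Rd t x)) (K := K) (L := L.toNNReal)
    (fun t => by
      have h := hK.comp (lipschitzWith_lawData Rd t)
      rw [mul_one] at h
      exact h)
    (fun x => hG.continuous.comp (continuous_lawData hRd2 x))
    (fun t x => (hLb _).trans (Real.le_coe_toNNReal L)) (ρ := ρ) (t₀ := t₀) (x₀ := x₀)
    (fun t ht x hx => by
      have h1 : χ (lawData Rd t x) = 1 := χ.one_of_mem_closedBall (by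
        rw [mem_closedBall_zero_iff]
        exact norm_lawData_le hRd (hB t (ht₀.trans ht)) hx)
      simp only [G, h1, one_smul, closedLoop_eq_field])
    hρ
    (fun t₁ ht₁ q hq0 hq => hbound t₁ ht₁ q hq0 fun t ht => ⟨hso t₁ q hq0 hq t ht, hq t ht⟩)
  refine ⟨q, fun t ht => ⟨?_, hq t ht⟩, hq0⟩
  exact hso t q hq0 (fun τ hτ => (hq τ hτ.1).mono Icc_subset_Ici_self) t ⟨ht, le_rfl⟩

/-- Compare with the state having the same attitude and rotor rates but zero velocity error, where
the residual vanishes. Both sets of law data lie in one compact ball, and they differ by exactly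
`e_ω`. -/
theorem exists_norm_residual_le (hRd : ∀ t, Rd t ∈ SO3)
    (hRd2 : ContDiff ℝ 2 Rd) (hf : ContDiff ℝ 1 fFF) {B : ℝ}
    (hB : ∀ t, 0 ≤ t → ‖desiredVelocity Rd t‖ ≤ B ∧ ‖deriv (desiredVelocity Rd) t‖ ≤ B)
    (hL : ∀ t : ℝ, 0 ≤ t → ∀ q : State, q.1 ∈ SO3 →
      lieDeriv (P.Fcl lam fFF Rd) (P.H lam Rd) t q = 0) (ρ : ℝ) :
    ∃ L, 0 ≤ L ∧ ∀ t, 0 ≤ t → ∀ q : State, q.1 ∈ SO3 → ‖q‖ ≤ ρ →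
      ‖P.residual fFF (lawData Rd t q)‖ ≤ L * ‖velocityError Rd t q‖ := by
  have hB0 : 0 ≤ B := (norm_nonneg _).trans (hB 0 le_rfl).1
  set r := max (max (max ρ (3 * B)) 1) B with hr
  obtain ⟨K, hK⟩ := LocallyLipschitzOn.exists_lipschitzOnWith_of_compact
    (isCompact_closedBall (0 : LawData) r)
    ((P.contDiff_residual hf).locallyLipschitz.locallyLipschitzOn)
  refine ⟨K, K.2, fun t ht q hq hqρ => ?_⟩
  set η := transported (Rd t) q.1 (desiredVelocity Rd t) with hη
  have hη3 : ‖η‖ ≤ 3 * B :=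
    (norm_transported_le (hRd t) hq _).trans (by linarith [(hB t ht).1])
  have hmem : ∀ x : State, ‖x‖ ≤ max ρ (3 * B) → lawData Rd t x ∈ Metric.closedBall 0 r :=
    fun x hx => mem_closedBall_zero_iff.2 (norm_lawData_le hRd (hB t ht) hx)
  have hz : P.residual fFF (lawData Rd t (q.1, η, q.2.2)) = 0 :=
    residual_eq_zero hf fun ω => residual_power hRd hRd2 hL ht (q := (q.1, ω, q.2.2)) hq
  have h1 : ‖((q.1, η, q.2.2) : State)‖ ≤ max ρ (3 * B) := by
    have h2 := (norm_fst_le q).trans hqρ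
    have h3 := (norm_snd_le q.2).trans ((norm_snd_le q).trans hqρ)
    exact max_le (h2.trans (le_max_left _ _))
      (max_le (hη3.trans (le_max_right _ _)) (h3.trans (le_max_left _ _)))
  have h2 := hK.dist_le_mul _ (hmem q (hqρ.trans (le_max_left _ _))) _ (hmem _ h1)
  rw [hz, dist_zero_right] at h2
  refine h2.trans ?_
  gcongr
  simp [lawData, velocityError, dist_eq_norm, ← hη]

end Robot

/-! ### The strict Lyapunov function and convergence. -/

/-- A function decreasing at rate at least `κ H` and bounded below forces the nonnegative
nonincreasing function `H` to tend to zero. -/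
theorem tendsto_zero_of_hasDerivWithinAt_le {W W' H H' : ℝ → ℝ} {t₀ κ D : ℝ} (hκ : 0 < κ)
    (hW : ∀ t ∈ Ici t₀, HasDerivWithinAt W (W' t) (Ici t₀) t)
    (hH : ∀ t ∈ Ici t₀, HasDerivWithinAt H (H' t) (Ici t₀) t)
    (hW' : ∀ t ∈ Ici t₀, W' t ≤ -(κ * H t)) (hH' : ∀ t ∈ Ici t₀, H' t ≤ 0)
    (hH0 : ∀ t ∈ Ici t₀, 0 ≤ H t) (hD : ∀ t ∈ Ici t₀, -D ≤ W t) : Tendsto H atTop (𝓝 0) := by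
  -- Monotonicity of `H` replaces the integral of `H` over `[t₀, t]` by its lower bound `(t - t₀) H
  -- t`; the outcome is `H = O(1 / (t - t₀))`.
  have hanti : AntitoneOn (fun t => W t + κ * ((t - t₀) * H t)) (Ici t₀) := by
    refine antitoneOn_of_hasDerivWithinAt_self (convex_Ici t₀) (fun t ht => (hW t ht).add
      ((((hasDerivWithinAt_id t _).sub_const t₀).mul (hH t ht)).const_mul κ)) fun t ht => ?_
    have h1 := hW' t ht
    have h2 : κ * ((t - t₀) * H' t) ≤ 0 := mul_nonpos_of_nonneg_of_nonpos hκ.le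
      (mul_nonpos_of_nonneg_of_nonpos (sub_nonneg.2 ht) (hH' t ht))
    simp only [one_mul, id_eq]
    linarith
  have hle : ∀ t, t₀ < t → H t ≤ (W t₀ + D) / κ / (t - t₀) := by
    intro t ht
    have h1 := hanti self_mem_Ici (mem_Ici.2 ht.le) ht.le
    have h2 := hD t ht.le
    simp only [sub_self, zero_mul, mul_zero, add_zero] at h1
    rw [le_div_iff₀ (sub_pos.2 ht), le_div_iff₀ hκ]
    linarith
  refine tendsto_of_tendsto_of_tendsto_of_le_of_le' tendsto_const_nhds
    (tendsto_const_nhds.div_atTop (tendsto_atTop_add_const_right atTop (-t₀) tendsto_id)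
      : Tendsto (fun t => (W t₀ + D) / κ / (t + -t₀)) atTop (𝓝 0))
    ((eventually_ge_atTop t₀).mono hH0) ((eventually_gt_atTop t₀).mono fun t ht => ?_)
  simpa only [sub_eq_add_neg] using hle t ht

theorem hasDerivWithinAt_attitudeError {Rd : ℝ → Mat} {s : Set ℝ} {t : ℝ} {q : ℝ → State}
    {q' : State} (hRd : ∀ t, Rd t ∈ SO3) (hRd2 : ContDiff ℝ 2 Rd)
    (h : HasDerivWithinAt q q' s t) (hR : (q t).1 ∈ SO3) (hq' : q'.1 = (q t).1 * hat (q t).2.1) :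
    HasDerivWithinAt (fun τ => attitudeError (Rd τ) (q τ).1)
      (vee ((Rd t)ᵀ * (q t).1 * hat (velocityError Rd t (q t))
        - ((Rd t)ᵀ * (q t).1 * hat (velocityError Rd t (q t)))ᵀ)) s t :=
  have hQ := hasDerivWithinAt_relative hRd hRd2 h hR hq'
  (hQ.sub hQ.matrix_transpose).vee_comp

namespace Robot

variable {P : Robot} {lam : Vec} {Kv : ℝ} {Rd : ℝ → Mat} {fFF : FeedforwardLaw}

/-- The cross term added to `H` to obtain a strict Lyapunov function. -/
noncomputable def crossTerm (P : Robot) (Rd : ℝ → Mat) (t : ℝ) (q : State) : ℝ :=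
  attitudeError (Rd t) q.1 ⬝ᵥ (P.M q.1 *ᵥ velocityError Rd t q)

theorem hasDerivWithinAt_crossTerm (hRd : ∀ t, Rd t ∈ SO3) (hRd2 : ContDiff ℝ 2 Rd)
    {s : Set ℝ} {t : ℝ} {q : ℝ → State} (hq : (q t).1 ∈ SO3)
    (h : HasDerivWithinAt q (P.closedLoop lam Kv fFF Rd t (q t)) s t) :
    HasDerivWithinAt (fun τ => P.crossTerm Rd τ (q τ))
      (vee ((Rd t)ᵀ * (q t).1 * hat (velocityError Rd t (q t))
          - ((Rd t)ᵀ * (q t).1 * hat (velocityError Rd t (q t)))ᵀ)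
          ⬝ᵥ (P.M (q t).1 *ᵥ velocityError Rd t (q t))
        + attitudeError (Rd t) (q t).1 ⬝ᵥ (P.residual fFF (lawData Rd t (q t))
            - Kv • velocityError Rd t (q t) - potentialDiff lam (Rd t) (q t).1)) s t := by
  rw [closedLoop_eq] at h
  have he := hasDerivWithinAt_velocityError hRd hRd2 h rfl
  refine ((hasDerivWithinAt_attitudeError hRd hRd2 h hq rfl).vec_dotProduct
    ((P.hasDerivWithinAt_M (h.attitude rfl)).matrix_mulVec he)).congr_deriv ?_
  congr 2
  rw [Matrix.mulVec_sub, M_mulVec_forced]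
  simp only [residual, lawData, gyro]
  rw [show (q t).2.1 - transported (Rd t) (q t).1 (desiredVelocity Rd t)
    = velocityError Rd t (q t) from rfl]
  abel

/-- The term `-z ⬝ dV` supplies at least `-V` near the desired attitude. Young's inequality spends
half of it on the mixed term in `‖z‖ ‖e‖`, and all other terms are quadratic in `e`. -/
theorem crossTerm_deriv_le {l C L : ℝ} (hKv : 0 < Kv) (hl : ∀ i, l ≤ lam i) (hl0 : 0 < l)
    {Rd R : Mat} (hRd : Rd ∈ SO3) (hR : R ∈ SO3) (hC : ‖P.M R‖ ≤ C)
    (hV : potential lam Rd R ≤ l) {e Y : Vec} (hY : ‖Y‖ ≤ L * ‖e‖) :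
    vee (Rdᵀ * R * hat e - (Rdᵀ * R * hat e)ᵀ) ⬝ᵥ (P.M R *ᵥ e)
      + attitudeError Rd R ⬝ᵥ (Y - Kv • e - potentialDiff lam Rd R)
      ≤ (54 * C + 36 * (L + Kv) ^ 2 / l) * ‖e‖ ^ 2 - potential lam Rd R / 2 := by
  have hQ := SO3.transpose_mul_mem hRd hR
  have hC0 : 0 ≤ C := (norm_nonneg _).trans hC
  have h1 : vee (Rdᵀ * R * hat e - (Rdᵀ * R * hat e)ᵀ) ⬝ᵥ (P.M R *ᵥ e) ≤ 54 * C * ‖e‖ ^ 2 := by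
    have ha : ‖vee (Rdᵀ * R * hat e - (Rdᵀ * R * hat e)ᵀ)‖ ≤ 2 * (3 * 1 * ‖e‖) := by
      refine (norm_vee_sub_transpose_le _).trans ?_
      gcongr
      refine (norm_matrix_mul_le _ _).trans ?_
      gcongr
      exacts [SO3.norm_le_one hQ, norm_hat_le e]
    have hb : ‖P.M R *ᵥ e‖ ≤ 3 * C * ‖e‖ := (norm_mulVec_le _ _).trans (by gcongr)
    calc _ ≤ _ := (le_abs_self _).trans (abs_dotProduct_le _ _)
      _ ≤ 3 * (2 * (3 * 1 * ‖e‖)) * (3 * C * ‖e‖) := by gcongr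
      _ = _ := by ring
  set z := attitudeError Rd R with hz
  have h2 : z ⬝ᵥ (Y - Kv • e) ≤ 3 * (L + Kv) * ‖z‖ * ‖e‖ := by
    have ha : ‖Y - Kv • e‖ ≤ (L + Kv) * ‖e‖ := by
      refine (norm_sub_le _ _).trans ?_
      rw [norm_smul, Real.norm_eq_abs, abs_of_pos hKv, add_mul]
      gcongr
    calc _ ≤ _ := (le_abs_self _).trans (abs_dotProduct_le _ _)
      _ ≤ 3 * ‖z‖ * ((L + Kv) * ‖e‖) := by gcongr
      _ = _ := by ring
  -- The weight `l / 16` is chosen so that `l ‖z‖² ≤ 8 V` turns the first term into at most `V / 2`.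
  have h3 : 3 * (L + Kv) * ‖z‖ * ‖e‖
      ≤ l / 16 * ‖z‖ ^ 2 + 36 * (L + Kv) ^ 2 / l * ‖e‖ ^ 2 := by
    have h : l / 16 * ‖z‖ ^ 2 + 36 * (L + Kv) ^ 2 / l * ‖e‖ ^ 2 - 3 * (L + Kv) * ‖z‖ * ‖e‖
        = (l * ‖z‖ - 24 * (L + Kv) * ‖e‖) ^ 2 / (16 * l) := by
      field_simp
      ring
    have : 0 ≤ (l * ‖z‖ - 24 * (L + Kv) * ‖e‖) ^ 2 / (16 * l) := by positivity
    linarith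
  have h4 := sq_norm_attitudeError_le hl hRd hR hl0
  have h5 : potential lam Rd R ≤ z ⬝ᵥ potentialDiff lam Rd R := by
    rw [attitudeError_dotProduct_potentialDiff hRd hR]
    have ha := sum_one_sub_diag_le_potential hl hRd hR
    have hb := sum_one_sub_diag_nonneg hRd hR
    have hc : ∑ i, (1 - (Rdᵀ * R) i i) = 3 - (Rdᵀ * R).trace := by
      simp [Matrix.trace]
    rw [hc] at ha hb
    -- The restriction `V ≤ l` forces trace at least `2`, which makes `1 + tr Q` at least `1` with
    -- room to spare.
    have hd : 3 - (Rdᵀ * R).trace ≤ 1 := by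
      by_contra! hcon
      nlinarith
    have hV0 : 0 ≤ potential lam Rd R := le_trans (by positivity) ha
    nlinarith
  rw [dotProduct_sub, add_mul]
  linarith

theorem tendsto_H (hlam : ∀ i, 0 < lam i) (hKv : 0 < Kv) (hRd : ∀ t, Rd t ∈ SO3)
    (hRd2 : ContDiff ℝ 2 Rd) (hf : ContDiff ℝ 1 fFF) {B : ℝ}
    (hB : ∀ t, 0 ≤ t → ‖desiredVelocity Rd t‖ ≤ B ∧ ‖deriv (desiredVelocity Rd) t‖ ≤ B)
    (hL : ∀ t : ℝ, 0 ≤ t → ∀ q : State, q.1 ∈ SO3 →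
      lieDeriv (P.Fcl lam fFF Rd) (P.H lam Rd) t q = 0)
    {l : ℝ} (hl : ∀ i, l ≤ lam i) (hl0 : 0 < l)
    {t₀ : ℝ} (ht₀ : 0 ≤ t₀) {q : ℝ → State}
    (hq : IsTrajectoryOn (P.closedLoop lam Kv fFF Rd) (Ici t₀) q)
    (hlt : P.H lam Rd t₀ (q t₀) < l) :
    Tendsto (fun t => P.H lam Rd t (q t)) atTop (𝓝 0) := by
  obtain ⟨m, hm0, hm⟩ := exists_pos_le P.I P.I_pos
  obtain ⟨C, hC0, hC⟩ := P.exists_norm_M_le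
  obtain ⟨ρ, -, hρ⟩ := exists_state_bound hlam hKv hRd hRd2 (fun t ht => (hB t ht).1) hL ht₀
    (hq t₀ self_mem_Ici).1
  have hqρ : ∀ t ∈ Ici t₀, ‖q t‖ ≤ ρ := fun t ht =>
    (hρ t ht q rfl (hq.mono Icc_subset_Ici_self)).le
  obtain ⟨L, hL0, hY⟩ := exists_norm_residual_le hRd hRd2 hf hB hL ρ
  have hH0 : ∀ t ∈ Ici t₀, 0 ≤ P.H lam Rd t (q t) := fun t ht =>
    P.H_nonneg hlam (hRd t) (hq t ht).1
  -- The smallness needed by `crossTerm_deriv_le` persists since `V ≤ H` and `H` is nonincreasing.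
  have hV : ∀ t ∈ Ici t₀, potential lam (Rd t) (q t).1 ≤ l := by
    intro t ht
    have h1 := antitoneOn_H hKv hRd hRd2 hL (convex_Ici t₀) (Ici_subset_Ici.2 ht₀) hq
      self_mem_Ici ht ht
    have h2 := P.le_H hm hm0 (lam := lam) (Rd := Rd) (t := t) (q := q t)
    have h3 : 0 ≤ m / 2 * ‖velocityError Rd t (q t)‖ ^ 2 := by positivity
    simp only at h1
    linarith
  set C₁ := 54 * C + 36 * (L + Kv) ^ 2 / l with hC₁
  have hC₁0 : 0 < C₁ := by positivity
  -- With this `c` the cross term consumes half the damping, leaving `W' ≤ -(K_v / 2) ‖e‖² - (c / 2)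
  -- V`. The choice of `κ` then matches `H ≤ V + (9 / 2) C ‖e‖²` term by term.
  set c := Kv / (2 * C₁) with hc
  have hc0 : 0 < c := by positivity
  have hcC : c * C₁ = Kv / 2 := by rw [hc]; field_simp
  set κ := min (c / 2) (Kv / (9 * C)) with hκ
  have hκ0 : 0 < κ := by positivity
  have hκ1 : κ ≤ c / 2 := min_le_left _ _
  have hκ2 : κ * (9 * C) ≤ Kv := (le_div_iff₀ (by positivity)).1 (min_le_right _ _)
  have hHd : ∀ t ∈ Ici t₀, HasDerivWithinAt (fun τ => P.H lam Rd τ (q τ)) _ (Ici t₀) t :=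
    fun t ht => hasDerivWithinAt_H_closedLoop hRd hRd2 hL (ht₀.trans ht) (hq t ht).1 (hq t ht).2
  -- `W` need not be positive: `D` bounds the scaled cross term on the bounded set containing the
  -- trajectory, and `H ≥ 0`.
  refine tendsto_zero_of_hasDerivWithinAt_le (D := c * (3 * (2 * 1) * (3 * C * (ρ + 3 * B)))) hκ0
    (fun t ht => (hHd t ht).add
      ((hasDerivWithinAt_crossTerm hRd hRd2 (hq t ht).1 (hq t ht).2).const_mul c)) hHd
    (fun t ht => ?_) (fun t ht => neg_nonpos.2 (mul_nonneg hKv.le (dotProduct_self_star_nonneg _)))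
    hH0 fun t ht => ?_
  · have h1 := crossTerm_deriv_le hKv hl hl0 (hRd t) (hq t ht).1 (hC _ (hq t ht).1) (hV t ht)
      (hY t (ht₀.trans ht) (q t) (hq t ht).1 (hqρ t ht))
    have h2 := mul_le_mul_of_nonneg_left h1 hc0.le
    have h3 := P.H_le (lam := lam) (Rd := Rd) (t := t) (hC _ (hq t ht).1)
    have h4 := mul_le_mul_of_nonneg_left (sq_norm_le_dotProduct_self (velocityError Rd t (q t)))
      hKv.le
    have h5 := mul_le_mul_of_nonneg_left h3 hκ0.le
    have h6 := mul_le_mul_of_nonneg_right hκ1 (potential_nonneg hlam (hRd t) (hq t ht).1)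
    have h7 := mul_le_mul_of_nonneg_right hκ2 (sq_nonneg ‖velocityError Rd t (q t)‖)
    rw [← hC₁, mul_sub, ← mul_assoc, hcC] at h2
    linarith
  · have hR := (hq t ht).1
    have hQ := SO3.norm_le_one (SO3.transpose_mul_mem (hRd t) hR)
    have h1 : ‖attitudeError (Rd t) (q t).1‖ ≤ 2 * 1 :=
      (norm_vee_sub_transpose_le _).trans (by gcongr)
    have h2 : ‖velocityError Rd t (q t)‖ ≤ ρ + 3 * B :=
      (norm_sub_le _ _).trans (add_le_add ((norm_fst_le _).trans ((norm_snd_le _).trans (hqρ t ht)))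
        ((norm_transported_le (hRd t) hR _).trans
          (by linarith [(hB t (ht₀.trans ht)).1])))
    have h3 : ‖P.M (q t).1 *ᵥ velocityError Rd t (q t)‖ ≤ 3 * C * (ρ + 3 * B) :=
      (norm_mulVec_le _ _).trans (by gcongr; exact hC _ hR)
    have h4 : -(3 * (2 * 1) * (3 * C * (ρ + 3 * B))) ≤ P.crossTerm Rd t (q t) := by
      refine neg_le_of_abs_le ((abs_dotProduct_le _ _).trans ?_)
      gcongr
    have h5 := mul_le_mul_of_nonneg_left h4 hc0.le
    have h6 := hH0 t ht
    rw [Pi.add_apply]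
    linarith

theorem locallyAsymptoticallyStable (hlam : ∀ i, 0 < lam i) (hKv : 0 < Kv)
    (hRd : ∀ t, Rd t ∈ SO3) (hRd2 : ContDiff ℝ 2 Rd) (hf : ContDiff ℝ 1 fFF) {B : ℝ}
    (hB : ∀ t, 0 ≤ t → ‖desiredVelocity Rd t‖ ≤ B ∧ ‖deriv (desiredVelocity Rd) t‖ ≤ B)
    (hL : ∀ t : ℝ, 0 ≤ t → ∀ q : State, q.1 ∈ SO3 →
      lieDeriv (P.Fcl lam fFF Rd) (P.H lam Rd) t q = 0) :
    LocallyAsymptoticallyStable (P.closedLoop lam Kv fFF Rd) Rd (desiredVelocity Rd) := by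
  have hB1 := fun t ht => (hB t ht).1
  intro t₀ ht₀
  refine ⟨fun ε hε => ?_, ?_⟩
  · obtain ⟨h, hh, hnear⟩ := P.near_of_H_lt hlam hRd hB1 hε
    obtain ⟨δ, hδ, hlt⟩ := P.H_lt_of_near (lam := lam) hRd t₀ hh
    refine ⟨δ, hδ, fun q hq hq0 t ht => hnear t (ht₀.trans ht) _ (hq t ht).1 ?_⟩
    exact (antitoneOn_H hKv hRd hRd2 hL (convex_Ici t₀) (Ici_subset_Ici.2 ht₀) hq
      self_mem_Ici ht ht).trans_lt (hlt _ hq0)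
  · obtain ⟨l, hl0, hl⟩ := exists_pos_le lam hlam
    obtain ⟨δ, hδ, hlt⟩ := P.H_lt_of_near (lam := lam) hRd t₀ hl0
    -- Existence holds from every initial state; the `δ` serves convergence only, by ensuring `H <
    -- l` initially.
    refine ⟨δ, hδ, fun x hx _ => exists_trajectory hlam hKv hRd hRd2 hf hB hL ht₀ hx,
      fun q hq hq0 => ?_⟩
    have hH := tendsto_H hlam hKv hRd hRd2 hf hB hL hl hl0 ht₀ hq (hlt _ hq0)
    have hev : ∀ ε > 0, ∀ᶠ t in atTop, Near (Rd t) (desiredVelocity Rd t) ε (q t) := by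
      intro ε hε
      obtain ⟨h, hh, hnear⟩ := P.near_of_H_lt hlam hRd hB1 hε
      filter_upwards [eventually_ge_atTop t₀, hH.eventually (gt_mem_nhds hh)] with t ht hHt
      exact hnear t (ht₀.trans ht) _ (hq t ht).1 hHt
    constructor
    · refine Metric.tendsto_nhds.2 fun ε hε => (hev ε hε).mono fun t ht => ?_
      rw [dist_zero_right]
      exact ht.1
    · refine Metric.tendsto_nhds.2 fun ε hε => (hev ε hε).mono fun t ht => ?_
      rw [dist_zero_right]
      exact ht.2

end Robot

/-! ### The theorem. -/

theorem theorem2 (P : Robot) (lam : Vec) (hlam : ∀ i, 0 < lam i) (Kv : ℝ) (hKv : 0 < Kv)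
    (Rd : ℝ → Mat) (hRd : ∀ t, Rd t ∈ SO3) (hRd2 : ContDiff ℝ 2 Rd)
    (fFF : FeedforwardLaw)
    (hfFF : fFF = P.feedforward ∨
      (ContDiff ℝ 1 fFF ∧ ∃ B : ℝ, ∀ t : ℝ, 0 ≤ t →
        ‖desiredVelocity Rd t‖ ≤ B ∧ ‖deriv (desiredVelocity Rd) t‖ ≤ B))
    (hL : ∀ t : ℝ, 0 ≤ t → ∀ q : State, q.1 ∈ SO3 →
      lieDeriv (P.Fcl lam fFF Rd) (P.H lam Rd) t q = 0) :
    (∀ t : ℝ, 0 ≤ t → ∀ q : State, q.1 ∈ SO3 →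
      P.uDiss lam Kv Rd t q = Kv • velocityError Rd t q) ∧
    (∀ s : Set ℝ, s ⊆ Ici 0 → ∀ q : ℝ → State,
      IsTrajectoryOn (P.closedLoop lam Kv fFF Rd) s q → ∀ t ∈ s,
        HasDerivWithinAt (fun τ => P.H lam Rd τ (q τ))
          (-(Kv * (velocityError Rd t (q t) ⬝ᵥ velocityError Rd t (q t)))) s t ∧
        -(Kv * (velocityError Rd t (q t) ⬝ᵥ velocityError Rd t (q t))) ≤ 0) ∧
    LocallyAsymptoticallyStable (P.closedLoop lam Kv fFF Rd) Rd (desiredVelocity Rd) := by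
  refine ⟨fun t _ q _ => P.uDiss_eq lam Kv Rd t q, fun s hs q hq t ht =>
    ⟨Robot.hasDerivWithinAt_H_closedLoop hRd hRd2 hL (hs ht) (hq t ht).1 (hq t ht).2,
      neg_nonpos.2 (mul_nonneg hKv.le (dotProduct_self_star_nonneg _))⟩, ?_⟩
  obtain ⟨hf, B, hB⟩ : ContDiff ℝ 1 fFF ∧ ∃ B : ℝ, ∀ t : ℝ, 0 ≤ t →
      ‖desiredVelocity Rd t‖ ≤ B ∧ ‖deriv (desiredVelocity Rd) t‖ ≤ B := by
    rcases hfFF with rfl | h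
    · exact ⟨P.contDiff_feedforward, 0, Robot.feedforward_bounded hRd hRd2 hL⟩
    · exact h
  exact Robot.locallyAsymptoticallyStable hlam hKv hRd hRd2 hf hB hL
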